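/- Let $f_0,\dots,f_{m-1}$ be contractive similitudes of $\mathbb{R}^n$ with contraction ratios $r_i\in(0,1)$, let $E$ be the self-similar set they generate (the nonempty compact set with $E=\bigcup_i f_i(E)$), and let $s>0$ be its similarity dimension, $\sum_i r_i^s=1$. A feasible open set is an open set $\mathcal{O}\subset\mathbb{R}^n$ with $f_i(\mathcal{O})\subset\mathcal{O}$ for all $i$, $f_i(\mathcal{O})\cap f_j(\mathcal{O})=\varnothing$ for $i\ne j$, and $\mathcal{O}\cap E\neq\varnothing$. Suppose that a feasible open set exists (the strong open set condition), and fix one, $\mathcal{O}$. Let $\mu$ be the natural probability measure on $E$, i.e. the compactly supported Borel probability measure with $\mu=\sum_i r_i^s\,\mu\circ f_i^{-1}$. Let $B(x,d)$ denote the closed ball with centre $x$ and radius $d>0$. For $A\subset\mathbb{R}^n$ let $\mathcal{H}^s(A)$ be the Hausdorff measure, $\lim_{\delta\to0}\inf\sum_i|U_i|^s$ over countable coverings of $A$ by sets $U_i$ of diameter $|U_i|\le\delta$; let $\mathcal{H}^s_{Sph}(A)$ be the spherical Hausdorff measure, $\lim_{\delta\to0}\inf\sum_i(2d_i)^s$ over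 countable coverings of $A$ by balls $B(x_i,d_i)$ with $2d_i\le\delta$; let $C^s(A)=\sup\{C^s_0(F):F\subset A\text{ closed}\}$ be the centred Hausdorff measure, where $C^s_0(F)$ is defined like $\mathcal{H}^s_{Sph}(F)$ but with all centres $x_i\in F$; and let $P^s(A)=\inf\{\sum_i P^s_0(F_i):A\subset\bigcup_{i}F_i,\ F_i\text{ closed}\}$ (countable coverings) be the packing measure, where $P^s_0(F)=\lim_{\delta\to0}\sup\sum_i(2d_i)^s$ over countable families of pairwise disjoint balls $B(x_i,d_i)$ with $x_i\in F$ and $2d_i\le\delta$. Let $\alpha$ be one of $\mu$, $\mathcal{H}^s\lfloor_E$, $\mathcal{H}^s_{Sph}\lfloor_E$, $C^s\lfloor_E$, $P^s\lfloor_E$, where $\beta\lfloor_E(A)=\beta(A\cap E)$. Put $\theta^s_\alpha(x,d)=\alpha(B(x,d))/(2d)^s$, $\underline\theta^s_\alpha(x)=\liminf_{d\to0^+}\theta^s_\alpha(x,d)$, $\overline\theta^s_\alpha(x)=\limsup_{d\to0^+}\theta^s_\alpha(x,d)$. For $A\subset\mathbb{R}^n$ let $Spec(\alpha,A)$ be the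 set of all limits $\lim_{k\to\infty}\theta^s_\alpha(x,d_k)$ with $x\in A$, $d_k>0$ and $d_k\to0$, and write $Spec(\alpha,x)=Spec(\alpha,\{x\})$. Call $B(x,d)$ a typical ball if $x\in E$ and $B(x,d)$ is contained in some feasible open set; let $\mathcal{B}$ be the set of typical balls and $\mathit{Im}(\theta^s_\alpha,\mathcal{B})=\{\theta^s_\alpha(x,d):B(x,d)\in\mathcal{B}\}$. Then: (i) For every $x\in E$, $Spec(\alpha,x)=[\underline\theta^s_\alpha(x),\overline\theta^s_\alpha(x)]$; and there are $0<\kappa_1\le\kappa_2<\infty$ with $Spec(\alpha,E)\subset[\kappa_1,\kappa_2]$. (ii) There is a (Borel) set $\widehat{E}\subset E$ with $\mu(\widehat{E})=1$ such that, for every $y\in\widehat{E}$, $Spec(\alpha,y)=Spec(\alpha,\widehat{E})=Spec(\alpha,\mathcal{O}\cap E)$. (iii) $$\left(\frac{\alpha(E)}{P^s(E)},\frac{\alpha(E)}{C^s(E)}\right)\subset\mathit{Im}(\theta^s_\alpha,\mathcal{B})\subset Spec(\alpha,\mathcal{O}\cap E)\subset\left[\frac{\alpha(E)}{P^s(E)},\frac{\alpha(E)}{C^s(E)}\right].$$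 -/

import Mathlib

open Set Filter MeasureTheory
open scoped ENNReal Topology

namespace SelfSimilarSpectrum

/-! ### Self-similar systems -/

/-- `f` is a finite system of contractive similitudes with contraction ratios `r`. -/
def IsSimilitudeSystem {n m : ℕ}
    (f : Fin m → EuclideanSpace ℝ (Fin n) → EuclideanSpace ℝ (Fin n)) (r : Fin m → ℝ) : Prop :=
  ∀ i, 0 < r i ∧ r i < 1 ∧ ∀ x y, dist (f i x) (f i y) = r i * dist x y

/-- `E` is the self-similar set generated by `f`: the nonempty compact set that is the union of
its images. -/
structure IsSelfSimilarSet {n m : ℕ}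
    (f : Fin m → EuclideanSpace ℝ (Fin n) → EuclideanSpace ℝ (Fin n))
    (E : Set (EuclideanSpace ℝ (Fin n))) : Prop where
  isCompact : IsCompact E
  nonempty : E.Nonempty
  eq_iUnion : E = ⋃ i, f i '' E

/-- `O` is a feasible open set for `f` and `E` (strong open set condition). -/
structure IsFeasible {n m : ℕ}
    (f : Fin m → EuclideanSpace ℝ (Fin n) → EuclideanSpace ℝ (Fin n))
    (E O : Set (EuclideanSpace ℝ (Fin n))) : Prop where
  isOpen : IsOpen O
  image_subset : ∀ i, f i '' O ⊆ O
  disjoint : ∀ i j, i ≠ j → Disjoint (f i '' O) (f j '' O)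
  inter_nonempty : (O ∩ E).Nonempty

/-- The closed ball `B(x, d)` is a typical ball: it is centred in `E` and contained in some
feasible open set. -/
def IsTypicalBall {n m : ℕ}
    (f : Fin m → EuclideanSpace ℝ (Fin n) → EuclideanSpace ℝ (Fin n))
    (E : Set (EuclideanSpace ℝ (Fin n))) (x : EuclideanSpace ℝ (Fin n)) (d : ℝ) : Prop :=
  x ∈ E ∧ 0 < d ∧ ∃ O, IsFeasible f E O ∧ Metric.closedBall x d ⊆ O

/-- `μ` is the natural probability measure: the compactly supported Borel probability measure
with `μ = ∑ i, (r i) ^ s • (f i)_♯ μ`. -/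
structure IsNaturalMeasure {n m : ℕ}
    (f : Fin m → EuclideanSpace ℝ (Fin n) → EuclideanSpace ℝ (Fin n)) (r : Fin m → ℝ) (s : ℝ)
    (μ : Measure (EuclideanSpace ℝ (Fin n))) : Prop where
  isProbabilityMeasure : IsProbabilityMeasure μ
  compactly_supported : ∃ K, IsCompact K ∧ μ Kᶜ = 0
  invariant : μ = ∑ i, ENNReal.ofReal (r i ^ s) • μ.map (f i)

/-! ### Metric measures

A countable family of closed balls is recorded as a countable set of pairs (centre, radius). -/

/-- A countable family of balls with positive radii and diameters `2 d ≤ δ`. -/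
def IsBallFamily {X : Type*} (δ : ℝ) (T : Set (X × ℝ)) : Prop :=
  T.Countable ∧ ∀ p ∈ T, 0 < p.2 ∧ 2 * p.2 ≤ δ

/-- The sum of `(2 d) ^ s` over the family. -/
noncomputable def ballSum {X : Type*} (s : ℝ) (T : Set (X × ℝ)) : ℝ≥0∞ :=
  ∑' p : T, ENNReal.ofReal (2 * (p : X × ℝ).2) ^ s

/-- The balls of the family cover `A`. -/
def Covers {X : Type*} [PseudoMetricSpace X] (T : Set (X × ℝ)) (A : Set X) : Prop :=
  A ⊆ ⋃ p ∈ T, Metric.closedBall p.1 p.2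

/-- The spherical Hausdorff measure `H_Sph^s`. -/
noncomputable def sphericalHausdorff {X : Type*} [PseudoMetricSpace X] (s : ℝ) (A : Set X) :
    ℝ≥0∞ :=
  ⨆ (δ : ℝ) (_ : 0 < δ), ⨅ (T : Set (X × ℝ)) (_ : IsBallFamily δ T ∧ Covers T A), ballSum s T

/-- The centred Hausdorff premeasure `C_0^s`: coverings of `A` by balls centred at points of
`A`. -/
noncomputable def centredPre {X : Type*} [PseudoMetricSpace X] (s : ℝ) (A : Set X) : ℝ≥0∞ :=
  ⨆ (δ : ℝ) (_ : 0 < δ), ⨅ (T : Set (X × ℝ))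
    (_ : IsBallFamily δ T ∧ (∀ p ∈ T, p.1 ∈ A) ∧ Covers T A), ballSum s T

/-- The centred Hausdorff measure `C^s`. -/
noncomputable def centredHausdorff {X : Type*} [PseudoMetricSpace X] (s : ℝ) (A : Set X) :
    ℝ≥0∞ :=
  ⨆ (F : Set X) (_ : F ⊆ A ∧ IsClosed F), centredPre s F

/-- The packing premeasure `P_0^s`: packings by pairwise disjoint closed balls centred at points
of `A`. -/
noncomputable def packingPre {X : Type*} [PseudoMetricSpace X] (s : ℝ) (A : Set X) : ℝ≥0∞ :=
  ⨅ (δ : ℝ) (_ : 0 < δ), ⨆ (T : Set (X × ℝ))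
    (_ : IsBallFamily δ T ∧ (∀ p ∈ T, p.1 ∈ A) ∧
      T.PairwiseDisjoint fun p => Metric.closedBall p.1 p.2), ballSum s T

/-- The packing measure `P^s`. -/
noncomputable def packingMeasure {X : Type*} [PseudoMetricSpace X] (s : ℝ) (A : Set X) : ℝ≥0∞ :=
  ⨅ (F : ℕ → Set X) (_ : (∀ i, IsClosed (F i)) ∧ A ⊆ ⋃ i, F i), ∑' i, packingPre s (F i)

/-- The family `{μ, H^s⌊E, H_Sph^s⌊E, C^s⌊E, P^s⌊E}`. Its members are given through their values
on sets; `β⌊E` is `A ↦ β (A ∩ E)`. -/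
noncomputable def metricMeasures {n : ℕ} (s : ℝ) (E : Set (EuclideanSpace ℝ (Fin n)))
    (μ : Measure (EuclideanSpace ℝ (Fin n))) : Set (Set (EuclideanSpace ℝ (Fin n)) → ℝ≥0∞) :=
  {fun A => μ A,
   fun A => Measure.hausdorffMeasure s (A ∩ E),
   fun A => sphericalHausdorff s (A ∩ E),
   fun A => centredHausdorff s (A ∩ E),
   fun A => packingMeasure s (A ∩ E)}

/-! ### Densities and spectra -/

/-- The density `θ_α^s(x, d) = α(B(x, d)) / (2 d) ^ s`, for `d > 0`. -/
noncomputable def density {X : Type*} [PseudoMetricSpace X] (α : Set X → ℝ≥0∞) (s : ℝ) (x : X)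
    (d : ℝ) : ℝ≥0∞ :=
  α (Metric.closedBall x d) / ENNReal.ofReal (2 * d) ^ s

/-- The lower spherical `s`-density at `x`. -/
noncomputable def lowerDensity {X : Type*} [PseudoMetricSpace X] (α : Set X → ℝ≥0∞) (s : ℝ)
    (x : X) : ℝ≥0∞ :=
  liminf (fun d : ℝ => density α s x d) (𝓝[>] 0)

/-- The upper spherical `s`-density at `x`. -/
noncomputable def upperDensity {X : Type*} [PseudoMetricSpace X] (α : Set X → ℝ≥0∞) (s : ℝ)
    (x : X) : ℝ≥0∞ :=
  limsup (fun d : ℝ => density α s x d) (𝓝[>] 0)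

/-- The asymptotic spectrum `Spec(α, A)`: all limits of `θ_α^s(x, d_k)` with `x ∈ A` and positive
radii `d_k → 0`. -/
def Spec {X : Type*} [PseudoMetricSpace X] (α : Set X → ℝ≥0∞) (s : ℝ) (A : Set X) : Set ℝ≥0∞ :=
  {L | ∃ x ∈ A, ∃ d : ℕ → ℝ, (∀ k, 0 < d k) ∧ Tendsto d atTop (𝓝 0) ∧
    Tendsto (fun k => density α s x (d k)) atTop (𝓝 L)}

/-- `Im(θ_α^s, B)`: the densities of the typical balls. -/
def typicalDensities {n m : ℕ}
    (f : Fin m → EuclideanSpace ℝ (Fin n) → EuclideanSpace ℝ (Fin n))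
    (E : Set (EuclideanSpace ℝ (Fin n))) (α : Set (EuclideanSpace ℝ (Fin n)) → ℝ≥0∞) (s : ℝ) :
    Set ℝ≥0∞ :=
  {t | ∃ x d, IsTypicalBall f E x d ∧ t = density α s x d}

end SelfSimilarSpectrum

namespace SelfSimilarSpectrum

/-! The heart is the case `α = μ`. A feasible open set is forward invariant and contains a cylinder,
so it has full `μ`-measure. Hence different cylinders do not overlap inside it, and the density of a
ball contained in it is unchanged when the ball is moved by any composition of the `f i`
(`density_wordMap`).

Almost every point `y` is rich: every finite word occurs arbitrarily late in some address of `y`. So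
at arbitrarily small scales around `y` one sees exact copies of balls that nearly coincide with any
given typical ball, and the density of that ball is a limit of densities at `y`
(`density_mem_Spec`). The rich points do not depend on `O`, so this covers balls typical for any
feasible set. Spectra at a point are closed, so at a rich point of `O ∩ E` the spectrum is that of
all of `O ∩ E`. It is an interval `[a, b]`: as the radius grows, the density can only jump upwards,
so a downward crossing of a level attains it. The same crossing puts every value in `(a, b)` among
the typical densities.

It remains to identify `a` and `b`. Almost every point has `b` as upper density, and no small ball
centred in `O ∩ E` exceeds it; Besicovitch coverings then give `b * C^s = μ` on Borel subsets of
`E`. Dually `a * P^s = μ`. With `μ E = 1`, `a = 1 / P^s(E)` and `b = 1 / C^s(E)`. The Ahlfors bounds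
`exists_lower_bound` and `exists_upper_bound` keep `a` and `b` positive and finite and control
exceptional sets of small measure.

For general `α`, `metricMeasures_eq` shows that `α` is a positive finite multiple of `μ` on closed
sets. For `C^s` and `P^s` this is the formula above; for the Hausdorff and spherical measures it
follows from scaling and countable subadditivity (`outerMeasure_inter_eq`). All densities are then
multiplied by `α E`. -/

lemma ofReal_two_mul_rpow_ne_zero {s d : ℝ} (hd : 0 < d) : ENNReal.ofReal (2 * d) ^ s ≠ 0 :=
  (ENNReal.rpow_pos (ENNReal.ofReal_pos.2 (by positivity)) ENNReal.ofReal_ne_top).ne'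

lemma ofReal_two_mul_rpow_ne_top {s d : ℝ} (hs : 0 ≤ s) : ENNReal.ofReal (2 * d) ^ s ≠ ∞ :=
  ENNReal.rpow_ne_top_of_nonneg hs ENNReal.ofReal_ne_top

/-! ### Spectra at a point -/

section Spectrum

variable {X : Type*} [PseudoMetricSpace X] {α : Set X → ℝ≥0∞} {s : ℝ}

/-- Cluster points along a countably generated filter are limits of sequences. In this form
closedness of the spectrum at a point is automatic. -/
lemma mem_Spec_singleton_iff {x : X} {L : ℝ≥0∞} :
    L ∈ Spec α s {x} ↔ MapClusterPt L (𝓝[>] 0) (density α s x) := by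
  constructor
  · rintro ⟨x, rfl, d, hd, hd0, hL⟩
    exact hL.mapClusterPt.of_comp (tendsto_nhdsWithin_iff.2 ⟨hd0, Eventually.of_forall hd⟩)
  · intro h
    have : (comap (density α s x) (𝓝 L) ⊓ 𝓝[>] 0).NeBot := by
      rw [inf_comm]
      exact (mapClusterPt_iff_ultrafilter.1 h).elim fun U hU =>
        (U.neBot).mono (le_inf hU.1 (tendsto_iff_comap.1 hU.2))
    obtain ⟨d, hd⟩ := exists_seq_tendsto (comap (density α s x) (𝓝 L) ⊓ 𝓝[>] 0)
    rw [tendsto_inf, tendsto_comap_iff, tendsto_nhdsWithin_iff] at hd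
    obtain ⟨N, hN⟩ := eventually_atTop.1 hd.2.2
    exact ⟨x, rfl, fun k => d (k + N), fun k => hN _ (Nat.le_add_left _ _),
      (tendsto_add_atTop_iff_nat N).2 hd.2.1, (tendsto_add_atTop_iff_nat N).2 hd.1⟩

lemma isClosed_Spec_singleton (x : X) : IsClosed (Spec α s {x}) := by
  have : Spec α s {x} = {L | MapClusterPt L (𝓝[>] 0) (density α s x)} :=
    ext fun _ => mem_Spec_singleton_iff
  rw [this]
  exact isClosed_setOfPred_clusterPt

/-- A monotone set function attains every density value that is crossed downwards. -/
lemma exists_density_eq (hs : 0 < s) {x : X}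
    (hα : Monotone fun d => α (Metric.closedBall x d)) {a b : ℝ} (ha : 0 < a) (hab : a ≤ b)
    {L : ℝ≥0∞} (hLa : L < density α s x a) (hLb : density α s x b < L) :
    ∃ c ∈ Icc a b, density α s x c = L := by
  have hpos {d : ℝ} (hd : 0 < d) := ofReal_two_mul_rpow_ne_zero (s := s) hd
  have htop (d : ℝ) := ofReal_two_mul_rpow_ne_top (d := d) hs.le
  have hcont (c : ℝ) : Tendsto (fun d => L * ENNReal.ofReal (2 * d) ^ s) (𝓝 c)
      (𝓝 (L * ENNReal.ofReal (2 * c) ^ s)) := by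
    refine ENNReal.Tendsto.const_mul ?_ (Or.inr hLa.ne_top)
    exact ((ENNReal.continuous_rpow_const.comp
      (ENNReal.continuous_ofReal.comp (continuous_const.mul continuous_id))).tendsto c)
  -- The last radius with density at least `L` works: monotonicity of the numerator carries `≥` to
  -- the supremum from the left and `≤` back to it from the right.
  set S := {d ∈ Icc a b | L ≤ density α s x d} with hS
  have hSne : S.Nonempty := ⟨a, ⟨le_rfl, hab⟩, hLa.le⟩
  have hSb : BddAbove S := ⟨b, fun d hd => hd.1.2⟩
  obtain ⟨u, -, hu, huS⟩ := exists_seq_tendsto_sSup hSne hSb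
  set c := sSup S
  have hac : a ≤ c := le_csSup hSb ⟨⟨le_rfl, hab⟩, hLa.le⟩
  have hcb : c ≤ b := csSup_le hSne fun d hd => hd.1.2
  have hc0 : 0 < c := ha.trans_le hac
  have hge : L * ENNReal.ofReal (2 * c) ^ s ≤ α (Metric.closedBall x c) := by
    refine le_of_tendsto ((hcont c).comp hu) (Eventually.of_forall fun k => ?_)
    have hk := (huS k).2
    have hk0 : 0 < u k := ha.trans_le (huS k).1.1
    rw [density, ENNReal.le_div_iff_mul_le (Or.inl (hpos hk0)) (Or.inl (htop _))] at hk
    exact hk.trans (hα (le_csSup hSb (huS k)))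
  have hge' : L ≤ density α s x c := by
    rwa [density, ENNReal.le_div_iff_mul_le (Or.inl (hpos hc0)) (Or.inl (htop _))]
  refine ⟨c, ⟨hac, hcb⟩, le_antisymm ?_ hge'⟩
  have hlt : c < b := lt_of_le_of_ne hcb fun h => (hLb.trans_le (h ▸ hge')).false
  rw [density, ENNReal.div_le_iff (hpos hc0) (htop _)]
  refine ge_of_tendsto ((hcont c).mono_left (nhdsWithin_le_nhds (s := Ioi c))) ?_
  filter_upwards [Ioo_mem_nhdsGT hlt] with d hd
  have hd0 : 0 < d := hc0.trans hd.1
  have : density α s x d < L := by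
    by_contra! h
    exact (le_csSup hSb (show d ∈ S from ⟨⟨hac.trans hd.1.le, hd.2.le⟩, h⟩)).not_gt hd.1
  rw [density, ENNReal.div_lt_iff (Or.inl (hpos hd0)) (Or.inl (htop _))] at this
  exact (hα hd.1.le).trans this.le

/-- The order of choice matters: first a radius `b` with density below `L`, then a smaller `a` with
density above. Only a crossing that goes down as the radius increases is sure to hit `L`. -/
lemma frequently_density_eq (hs : 0 < s) {x : X}
    (hα : Monotone fun d => α (Metric.closedBall x d)) {L : ℝ≥0∞}
    (hL : L ∈ Ioo (lowerDensity α s x) (upperDensity α s x)) :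
    ∃ᶠ d in 𝓝[>] 0, density α s x d = L := by
  rw [(nhdsGT_basis (0 : ℝ)).frequently_iff]
  intro δ hδ
  obtain ⟨b, hb, hbL⟩ := ((nhdsGT_basis (0 : ℝ)).frequently_iff.1
    (frequently_lt_of_liminf_lt (by isBoundedDefault) hL.1)) δ hδ
  obtain ⟨a, ha, haL⟩ := ((nhdsGT_basis (0 : ℝ)).frequently_iff.1
    (frequently_lt_of_lt_limsup (by isBoundedDefault) hL.2)) b hb.1
  obtain ⟨c, hc, h⟩ := exists_density_eq hs hα ha.1 ha.2.le haL hbL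
  exact ⟨c, ⟨ha.1.trans_le hc.1, hc.2.trans_lt hb.2⟩, h⟩

lemma Spec_singleton_eq_Icc (hs : 0 < s) {x : X}
    (hα : Monotone fun d => α (Metric.closedBall x d)) :
    Spec α s {x} = Icc (lowerDensity α s x) (upperDensity α s x) := by
  apply Subset.antisymm
  · rintro L ⟨x, rfl, d, hd, hd0, hL⟩
    have hd' : Tendsto d atTop (𝓝[>] 0) :=
      tendsto_nhdsWithin_iff.2 ⟨hd0, Eventually.of_forall hd⟩
    constructor
    · rw [← hL.liminf_eq]
      exact liminf_le_liminf_of_le (u := density α s x) hd'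
    · rw [← hL.limsup_eq]
      exact limsup_le_limsup_of_le (u := density α s x) hd'
  · have hle : lowerDensity α s x ≤ upperDensity α s x := liminf_le_limsup
    rcases hle.eq_or_lt with h | h
    · rw [h, Icc_self, singleton_subset_iff, mem_Spec_singleton_iff]
      exact (tendsto_of_liminf_eq_limsup h rfl).mapClusterPt
    · rw [← closure_Ioo h.ne]
      refine (isClosed_Spec_singleton x).closure_subset_iff.2 fun L hL => ?_
      rw [mem_Spec_singleton_iff, mapClusterPt_iff_frequently]
      intro U hU
      exact (frequently_density_eq hs hα hL).mono fun d hd => hd ▸ mem_of_mem_nhds hU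

end Spectrum

/-! ### Comparison of premeasures with a measure -/

section Comparison

variable {n : ℕ} {s : ℝ} {μ : Measure (EuclideanSpace ℝ (Fin n))}
  {F G : Set (EuclideanSpace ℝ (Fin n))} {c : ℝ≥0∞}

/-- Centred covers by small balls of density at least `c` have total size at most `μ F / c`. -/
lemma exists_centred_cover [IsFiniteMeasure μ]
    (hF : ∀ x ∈ F, ∀ δ > 0, ∃ d ∈ Ioo 0 δ,
      c * ENNReal.ofReal (2 * d) ^ s ≤ μ (Metric.closedBall x d))
    {δ : ℝ} (hδ : 0 < δ) {ε : ℝ≥0∞} (hε : ε ≠ 0) :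
    ∃ T : Set (EuclideanSpace ℝ (Fin n) × ℝ), IsBallFamily δ T ∧ (∀ p ∈ T, p.1 ∈ F) ∧
      Covers T F ∧ c * ballSum s T ≤ μ F + ε := by
  obtain ⟨t, ρ, htc, htF, hρ, hcov, hsum⟩ := Besicovitch.exists_closedBall_covering_tsum_measure_le
    μ hε (fun x => {d | d ∈ Ioo 0 (δ / 2) ∧
      c * ENNReal.ofReal (2 * d) ^ s ≤ μ (Metric.closedBall x d)}) F (fun x hx η hη => by
        obtain ⟨d, hd, h⟩ := hF x hx (min η (δ / 2)) (by positivity)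
        exact ⟨d, ⟨⟨hd.1, hd.2.trans_le (min_le_right _ _)⟩, h⟩, hd.1,
          hd.2.trans_le (min_le_left _ _)⟩)
  refine ⟨(fun x => (x, ρ x)) '' t, ⟨htc.image _, ?_⟩, ?_, ?_, ?_⟩
  · rintro _ ⟨x, hx, rfl⟩
    exact ⟨(hρ x hx).1.1, by linarith [(hρ x hx).1.2]⟩
  · rintro _ ⟨x, hx, rfl⟩
    exact htF hx
  · rw [Covers, biUnion_image]
    exact hcov
  · refine le_trans ?_ hsum
    rw [ballSum, tsum_image (fun p : EuclideanSpace ℝ (Fin n) × ℝ => ENNReal.ofReal (2 * p.2) ^ s)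
      (fun x _ y _ h => congrArg Prod.fst h), ← ENNReal.tsum_mul_left]
    exact ENNReal.tsum_le_tsum fun x => (hρ x x.2).2

lemma ballSum_union_le (T U : Set (EuclideanSpace ℝ (Fin n) × ℝ)) :
    ballSum s (T ∪ U) ≤ ballSum s T + ballSum s U :=
  ENNReal.tsum_union_le (fun p : EuclideanSpace ℝ (Fin n) × ℝ => ENNReal.ofReal (2 * p.2) ^ s) T U

/-- Upper bound for the centred premeasure by a density bound that may fail on a null set. -/
lemma mul_centredPre_le [IsFiniteMeasure μ] (hc0 : c ≠ 0) (hc : c ≠ ∞) (hGF : G ⊆ F)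
    (hG : ∀ x ∈ G, ∀ δ > 0, ∃ d ∈ Ioo 0 δ,
      c * ENNReal.ofReal (2 * d) ^ s ≤ μ (Metric.closedBall x d))
    (hnull : μ (F \ G) = 0) {c' : ℝ≥0∞} (hc0' : c' ≠ 0) (hc' : c' ≠ ∞)
    (hF : ∀ x ∈ F, ∀ δ > 0, ∃ d ∈ Ioo 0 δ,
      c' * ENNReal.ofReal (2 * d) ^ s ≤ μ (Metric.closedBall x d)) :
    c * centredPre s F ≤ μ F := by
  rw [mul_comm, ← ENNReal.le_div_iff_mul_le (Or.inl hc0) (Or.inl hc)]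
  refine iSup₂_le fun δ hδ => ?_
  rw [ENNReal.le_div_iff_mul_le (Or.inl hc0) (Or.inl hc), mul_comm]
  have key (ε : ℝ≥0∞) (hε : ε ≠ 0) : c * (⨅ (T : Set (EuclideanSpace ℝ (Fin n) × ℝ))
      (_ : IsBallFamily δ T ∧ (∀ p ∈ T, p.1 ∈ F) ∧ Covers T F), ballSum s T) ≤
      μ F + (ε + c / c' * ε) := by
    obtain ⟨T, hT, hTG, hTc, hTs⟩ := exists_centred_cover hG hδ hε
    -- The null set `F \ G` is covered using the cruder constant `c'`, at a cost of at most `ε /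
    -- c'`.
    obtain ⟨U, hU, hUF, hUc, hUs⟩ := exists_centred_cover
      (fun x (hx : x ∈ F \ G) => hF x hx.1) hδ hε
    have hTU : IsBallFamily δ (T ∪ U) ∧ (∀ p ∈ T ∪ U, p.1 ∈ F) ∧ Covers (T ∪ U) F := by
      refine ⟨⟨hT.1.union hU.1, ?_⟩, ?_, ?_⟩
      · rintro p (hp | hp)
        exacts [hT.2 p hp, hU.2 p hp]
      · rintro p (hp | hp)
        exacts [hGF (hTG p hp), (hUF p hp).1]
      · rw [Covers, biUnion_union]
        intro x hx
        by_cases hxG : x ∈ G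
        · exact Or.inl (hTc hxG)
        · exact Or.inr (hUc ⟨hx, hxG⟩)
    rw [hnull, zero_add, mul_comm, ← ENNReal.le_div_iff_mul_le (Or.inl hc0') (Or.inl hc')] at hUs
    calc _ ≤ c * (ballSum s T + ballSum s U) := by
          gcongr
          exact (iInf₂_le (T ∪ U) hTU).trans (ballSum_union_le T U)
      _ ≤ (μ G + ε) + c * (ε / c') := by
          rw [mul_add]
          gcongr
      _ ≤ μ F + (ε + c / c' * ε) := by
          rw [← add_assoc, ENNReal.div_eq_inv_mul, ENNReal.div_eq_inv_mul, mul_left_comm, mul_assoc]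
          gcongr
  have hlim : Tendsto (fun ε : ℝ≥0∞ => μ F + (ε + c / c' * ε)) (𝓝[>] 0) (𝓝 (μ F)) := by
    have h1 : Tendsto (fun ε : ℝ≥0∞ => ε) (𝓝[>] 0) (𝓝 0) := nhdsWithin_le_nhds
    have h2 := ENNReal.Tendsto.const_mul (a := c / c') h1
      (Or.inr (ENNReal.div_ne_top hc hc0'))
    simpa using (tendsto_const_nhds (x := μ F)).add (h1.add h2)
  exact ge_of_tendsto hlim (eventually_nhdsWithin_of_forall fun ε hε => key ε (ne_of_gt hε))

/-- Lower bound for the centred premeasure. -/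
lemma le_mul_centredPre (hc0 : c ≠ 0) (hc : c ≠ ∞) {δ : ℝ} (hδ : 0 < δ)
    (hF : ∀ x ∈ F, ∀ d, 0 < d → d ≤ δ →
      μ (Metric.closedBall x d) ≤ c * ENNReal.ofReal (2 * d) ^ s) :
    μ F ≤ c * centredPre s F := by
  rw [mul_comm, ← ENNReal.div_le_iff hc0 hc]
  refine le_trans ?_ (le_iSup₂ δ hδ)
  refine le_iInf₂ fun T hT => ?_
  rw [ENNReal.div_le_iff hc0 hc, mul_comm, ballSum, ← ENNReal.tsum_mul_left]
  have := hT.1.1.to_subtype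
  calc μ F ≤ μ (⋃ p ∈ T, Metric.closedBall p.1 p.2) := measure_mono hT.2.2
    _ ≤ ∑' p : T, μ (Metric.closedBall (p : EuclideanSpace ℝ (Fin n) × ℝ).1 
          (p : EuclideanSpace ℝ (Fin n) × ℝ).2) :=
        measure_biUnion_le μ hT.1.1 _
    _ ≤ _ := ENNReal.tsum_le_tsum fun p => by
        have h := hT.1.2 p p.2
        exact hF _ (hT.2.1 p p.2) _ h.1 (by linarith)

/-- Upper bound for the packing premeasure. -/
lemma mul_packingPre_le [IsFiniteMeasure μ] (hc0 : c ≠ 0) (hc : c ≠ ∞) (hFc : IsClosed F) {δ₀ : ℝ} (hδ₀ : 0 < δ₀)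
    (hF : ∀ x ∈ F, ∀ d, 0 < d → d ≤ δ₀ →
      c * ENNReal.ofReal (2 * d) ^ s ≤ μ (Metric.closedBall x d)) :
    c * packingPre s F ≤ μ F := by
  -- Disjoint balls of diameter at most `δ` centred in `F` all lie in the `δ`-thickening, whose
  -- measure tends to `μ F` because `F` is closed.
  have key {δ : ℝ} (hδ : 0 < δ) (hδ' : δ ≤ δ₀) :
      c * packingPre s F ≤ μ (Metric.cthickening δ F) := by
    rw [mul_comm, ← ENNReal.le_div_iff_mul_le (Or.inl hc0) (Or.inl hc)]
    refine (iInf₂_le δ hδ).trans (iSup₂_le fun T hT => ?_)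
    rw [ENNReal.le_div_iff_mul_le (Or.inl hc0) (Or.inl hc), mul_comm, ballSum,
      ← ENNReal.tsum_mul_left]
    calc _ ≤ ∑' p : T, μ (Metric.closedBall (p : EuclideanSpace ℝ (Fin n) × ℝ).1
          (p : EuclideanSpace ℝ (Fin n) × ℝ).2) := ENNReal.tsum_le_tsum fun p => by
          have h := hT.1.2 p p.2
          exact hF _ (hT.2.1 p p.2) _ h.1 (by linarith)
      _ = μ (⋃ p ∈ T, Metric.closedBall p.1 p.2) :=
          (measure_biUnion hT.1.1 hT.2.2 fun p _ => Metric.isClosed_closedBall.measurableSet).symm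
      _ ≤ _ := measure_mono <| iUnion₂_subset fun p hp => by
          have h := hT.1.2 p hp
          exact (Metric.closedBall_subset_cthickening (hT.2.1 p hp) _).trans
            (Metric.cthickening_mono (by linarith) _)
  have hlim := (tendsto_measure_cthickening_of_isClosed (μ := μ) ⟨1, one_pos, measure_ne_top _ _⟩
    hFc).mono_left (nhdsWithin_le_nhds (s := Ioi 0))
  refine ge_of_tendsto hlim ?_
  filter_upwards [Ioc_mem_nhdsGT hδ₀] with δ hδ using key hδ.1 hδ.2

/-- Lower bound for the packing premeasure. -/
lemma le_mul_packingPre [IsFiniteMeasure μ] (hc0 : c ≠ 0) (hc : c ≠ ∞) (hGF : G ⊆ F)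
    (hG : ∀ x ∈ G, ∀ δ > 0, ∃ d ∈ Ioo 0 δ,
      μ (Metric.closedBall x d) ≤ c * ENNReal.ofReal (2 * d) ^ s) :
    μ G ≤ c * packingPre s F := by
  rw [mul_comm, ← ENNReal.div_le_iff hc0 hc]
  refine le_iInf₂ fun δ hδ => ?_
  -- Disjoint balls that exhaust almost all of `G` form a packing of size at least `μ G / c`.
  obtain ⟨t, ρ, htc, htG, hρ, hcov, hdis⟩ := Besicovitch.exists_disjoint_closedBall_covering_ae
    μ (fun x => {d | μ (Metric.closedBall x d) ≤ c * ENNReal.ofReal (2 * d) ^ s}) G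
    (fun x hx η hη => by
      obtain ⟨d, hd, h⟩ := hG x hx η hη
      exact ⟨d, h, hd⟩) (fun _ => δ / 2) (fun _ _ => half_pos hδ)
  refine le_trans ?_ (le_iSup₂ ((fun x => (x, ρ x)) '' t) ⟨⟨htc.image _, ?_⟩, ?_, ?_⟩)
  · rw [ENNReal.div_le_iff hc0 hc, mul_comm, ballSum,
      tsum_image (fun p : EuclideanSpace ℝ (Fin n) × ℝ => ENNReal.ofReal (2 * p.2) ^ s)
      (fun x _ y _ h => congrArg Prod.fst h), ← ENNReal.tsum_mul_left]
    calc μ G ≤ μ (⋃ x ∈ t, Metric.closedBall x (ρ x)) +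
            μ (G \ ⋃ x ∈ t, Metric.closedBall x (ρ x)) :=
          (measure_mono (by rw [union_sdiff_self]; exact subset_union_right)).trans
            (measure_union_le _ _)
      _ ≤ ∑' x : t, μ (Metric.closedBall (x : EuclideanSpace ℝ (Fin n)) (ρ x)) := by
          rw [hcov, add_zero]
          exact measure_biUnion_le μ htc _
      _ ≤ _ := ENNReal.tsum_le_tsum fun x => (hρ x x.2).1
  · rintro _ ⟨x, hx, rfl⟩
    exact ⟨(hρ x hx).2.1, by linarith [(hρ x hx).2.2]⟩
  · rintro _ ⟨x, hx, rfl⟩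
    exact hGF (htG hx)
  · rintro _ ⟨x, hx, rfl⟩ _ ⟨y, hy, rfl⟩ hxy
    exact hdis hx hy fun h => hxy (by rw [h])

end Comparison

/-! ### Words -/

/-- The composition of the maps along a word. -/
def wordMap {X : Type*} {m : ℕ} (f : Fin m → X → X) : List (Fin m) → X → X
  | [] => id
  | i :: w => f i ∘ wordMap f w

/-- The product of the ratios along a word. -/
def wordRatio {m : ℕ} (r : Fin m → ℝ) : List (Fin m) → ℝ
  | [] => 1
  | i :: w => r i * wordRatio r w

variable {n m : ℕ} {f : Fin m → EuclideanSpace ℝ (Fin n) → EuclideanSpace ℝ (Fin n)}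
  {r : Fin m → ℝ} {E O : Set (EuclideanSpace ℝ (Fin n))} {s : ℝ}
  {μ : Measure (EuclideanSpace ℝ (Fin n))}

lemma wordMap_append {X : Type*} (f : Fin m → X → X) (v w : List (Fin m)) (x : X) :
    wordMap f (v ++ w) x = wordMap f v (wordMap f w x) := by
  induction v with
  | nil => rfl
  | cons i v ih => simp [wordMap, ih]

namespace IsSimilitudeSystem

lemma wordRatio_pos (hf : IsSimilitudeSystem f r) (w : List (Fin m)) : 0 < wordRatio r w := by
  induction w with
  | nil => simp [wordRatio]
  | cons i w ih => exact mul_pos (hf i).1 ih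

lemma dist_wordMap (hf : IsSimilitudeSystem f r) (w : List (Fin m))
    (x y : EuclideanSpace ℝ (Fin n)) :
    dist (wordMap f w x) (wordMap f w y) = wordRatio r w * dist x y := by
  induction w with
  | nil => simp [wordMap, wordRatio]
  | cons i w ih => simp [wordMap, wordRatio, (hf i).2.2, ih, mul_assoc]

lemma exists_bounds (hf : IsSimilitudeSystem f r) :
    ∃ p q : ℝ, 0 < p ∧ p < 1 ∧ 0 < q ∧ q < 1 ∧ ∀ i, p ≤ r i ∧ r i ≤ q := by
  rcases isEmpty_or_nonempty (Fin m) with h | h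
  · exact ⟨1 / 2, 1 / 2, by norm_num, by norm_num, by norm_num, by norm_num, fun i => h.elim i⟩
  · obtain ⟨i, hi⟩ := Finite.exists_min r
    obtain ⟨j, hj⟩ := Finite.exists_max r
    exact ⟨r i, r j, (hf i).1, (hf i).2.1, (hf j).1, (hf j).2.1, fun k => ⟨hi k, hj k⟩⟩

lemma wordRatio_le_pow {q : ℝ} (hf : IsSimilitudeSystem f r) (hq : ∀ i, r i ≤ q)
    (w : List (Fin m)) : wordRatio r w ≤ q ^ w.length := by
  induction w with
  | nil => simp [wordRatio]
  | cons i w ih =>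
    rw [List.length_cons, pow_succ']
    exact mul_le_mul (hq i) ih (hf.wordRatio_pos w).le ((hf i).1.le.trans (hq i))

lemma lipschitz (hf : IsSimilitudeSystem f r) (i : Fin m) :
    LipschitzWith (r i).toNNReal (f i) :=
  LipschitzWith.of_dist_le_mul fun x y => by
    rw [(hf i).2.2, Real.coe_toNNReal _ (hf i).1.le]

lemma continuous (hf : IsSimilitudeSystem f r) (i : Fin m) : Continuous (f i) :=
  (hf.lipschitz i).continuous

lemma measurable (hf : IsSimilitudeSystem f r) (i : Fin m) : Measurable (f i) :=
  (hf.continuous i).measurable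

lemma continuous_wordMap (hf : IsSimilitudeSystem f r) (w : List (Fin m)) :
    Continuous (wordMap f w) := by
  induction w with
  | nil => exact continuous_id
  | cons i w ih => exact (hf.continuous i).comp ih

lemma injective (hf : IsSimilitudeSystem f r) (i : Fin m) : Function.Injective (f i) := by
  intro x y h
  have := (hf i).2.2 x y
  rw [h, dist_self] at this
  exact dist_eq_zero.1 ((mul_eq_zero.1 this.symm).resolve_left (hf i).1.ne')

/-- Divided by its ratio, a similitude is an isometry. Strict convexity makes it affine, and an
injective linear map between spaces of equal finite dimension is onto. -/
lemma surjective (hf : IsSimilitudeSystem f r) (i : Fin m) : Function.Surjective (f i) := by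
  have hr := (hf i).1
  have hg : Isometry fun x => (r i)⁻¹ • f i x := Isometry.of_dist_eq fun x y => by
    rw [dist_smul₀, (hf i).2.2, Real.norm_eq_abs, abs_of_pos (inv_pos.2 hr),
      inv_mul_cancel_left₀ hr.ne']
  have hL := (hg.affineIsometryOfStrictConvexSpace.linearIsometry.toLinearIsometryEquiv
    rfl).surjective
  intro y
  have hs : Function.Surjective hg.affineIsometryOfStrictConvexSpace :=
    hg.affineIsometryOfStrictConvexSpace.toAffineMap.linear_surjective_iff.1 hL
  obtain ⟨x, hx⟩ := hs ((r i)⁻¹ • y)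
  refine ⟨x, smul_right_injective _ (inv_pos.2 hr).ne' ?_⟩
  simpa using hx

lemma surjective_wordMap (hf : IsSimilitudeSystem f r) (w : List (Fin m)) :
    Function.Surjective (wordMap f w) := by
  induction w with
  | nil => exact Function.surjective_id
  | cons i w ih => exact (hf.surjective i).comp ih

lemma image_wordMap_closedBall (hf : IsSimilitudeSystem f r) (w : List (Fin m))
    (x : EuclideanSpace ℝ (Fin n)) (d : ℝ) :
    wordMap f w '' Metric.closedBall x d =
      Metric.closedBall (wordMap f w x) (wordRatio r w * d) := by
  ext y
  obtain ⟨y, rfl⟩ := hf.surjective_wordMap w y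
  have hpos := hf.wordRatio_pos w
  constructor
  · rintro ⟨z, hz, h⟩
    rw [← h, Metric.mem_closedBall, hf.dist_wordMap]
    exact mul_le_mul_of_nonneg_left hz hpos.le
  · intro h
    rw [Metric.mem_closedBall, hf.dist_wordMap] at h
    exact ⟨y, le_of_mul_le_mul_left h hpos, rfl⟩

end IsSimilitudeSystem

/-! ### The attractor -/

namespace IsSelfSimilarSet

lemma mapsTo (hE : IsSelfSimilarSet f E) (i : Fin m) : MapsTo (f i) E E := fun x hx => by
  rw [hE.eq_iUnion]
  exact mem_iUnion.2 ⟨i, mem_image_of_mem _ hx⟩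

lemma exists_bound (hE : IsSelfSimilarSet f E) :
    ∃ D : ℝ, 1 ≤ D ∧ ∀ x ∈ E, ∀ y ∈ E, dist x y ≤ D :=
  ⟨max 1 (Metric.diam E), le_max_left _ _, fun _ hx _ hy =>
    (Metric.dist_le_diam_of_mem hE.isCompact.isBounded hx hy).trans (le_max_right _ _)⟩

/-- Every point of the attractor lies in a cylinder of prescribed size. -/
lemma exists_word (hf : IsSimilitudeSystem f r) (hE : IsSelfSimilarSet f E) {p : ℝ}
    (hp1 : p < 1) (hp : ∀ i, p ≤ r i) {x : EuclideanSpace ℝ (Fin n)} (hx : x ∈ E) {η : ℝ}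
    (hη : 0 < η) (hη1 : η ≤ 1) :
    ∃ w : List (Fin m), x ∈ wordMap f w '' E ∧ p * η ≤ wordRatio r w ∧ wordRatio r w ≤ η := by
  obtain ⟨_, q, _, _, hq0, hq1, hq⟩ := hf.exists_bounds
  obtain ⟨k, hk⟩ := exists_pow_lt_of_lt_one hη hq1
  replace hk := hk.le
  -- Invariant: `q ^ k ≤ η`. The word ends at the first letter with `r i ≤ η`, where `p * η ≤ p ≤ r
  -- i`; otherwise the letter is removed and `η` becomes `η / r i`.
  induction k generalizing x η with
  | zero =>
    refine ⟨[], by simpa [wordMap] using hx, ?_, ?_⟩ <;> simp only [wordRatio]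
    · nlinarith
    · simpa using hk
  | succ k ih =>
    have hx' := hx
    rw [hE.eq_iUnion] at hx'
    obtain ⟨i, x', hxE, rfl⟩ := mem_iUnion.1 hx'
    have hr := (hf i).1
    rcases le_or_gt (r i) η with h | h
    · refine ⟨[i], ⟨x', hxE, rfl⟩, ?_, by simpa [wordRatio]⟩
      simp only [wordRatio, mul_one]
      have := hp i
      nlinarith
    · obtain ⟨w, ⟨z, hz, hzx⟩, h1, h2⟩   := ih hxE (div_pos hη hr) ((div_le_one hr).2 h.le) (by
        rw [le_div_iff₀ hr]
        refine le_trans ?_ hk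
        rw [pow_succ]
        exact mul_le_mul_of_nonneg_left (hq i).2 (pow_nonneg hq0.le _))
      refine ⟨i :: w, ⟨z, hz, by simp [wordMap, hzx]⟩, ?_, ?_⟩ <;> simp only [wordRatio]
      · rw [← mul_div_assoc, div_le_iff₀ hr] at h1
        linarith
      · rw [le_div_iff₀ hr] at h2
        linarith

end IsSelfSimilarSet

/-! ### The natural measure -/

lemma sum_ofReal_rpow_eq_one (hf : IsSimilitudeSystem f r) (hdim : ∑ i, r i ^ s = 1) :
    ∑ i, ENNReal.ofReal (r i ^ s) = 1 := by
  rw [← ENNReal.ofReal_sum_of_nonneg fun i _ => Real.rpow_nonneg (hf i).1.le _, hdim,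
    ENNReal.ofReal_one]

namespace IsNaturalMeasure

lemma apply (hf : IsSimilitudeSystem f r) (hμ : IsNaturalMeasure f r s μ)
    {A : Set (EuclideanSpace ℝ (Fin n))} (hA : MeasurableSet A) :
    μ A = ∑ i, ENNReal.ofReal (r i ^ s) * μ (f i ⁻¹' A) := by
  conv_lhs => rw [hμ.invariant]
  rw [Measure.finsetSum_apply]
  exact Finset.sum_congr rfl fun i _ => by
    rw [Measure.smul_apply, Measure.map_apply (hf.measurable i) hA, smul_eq_mul]

lemma le_wordMap (hf : IsSimilitudeSystem f r) (hμ : IsNaturalMeasure f r s μ)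
    {A : Set (EuclideanSpace ℝ (Fin n))} (hA : MeasurableSet A) (w : List (Fin m)) :
    ENNReal.ofReal (wordRatio r w ^ s) * μ (wordMap f w ⁻¹' A) ≤ μ A := by
  induction w generalizing A with
  | nil => simp [wordRatio, wordMap]
  | cons i w ih =>
    rw [hμ.apply hf hA]
    refine le_trans ?_ (Finset.single_le_sum (fun _ _ => zero_le) (Finset.mem_univ i))
    rw [wordRatio, Real.mul_rpow (hf i).1.le (hf.wordRatio_pos w).le,
      ENNReal.ofReal_mul (Real.rpow_nonneg (hf i).1.le _), mul_assoc]
    gcongr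
    exact ih (hf.measurable i hA)

/-- Each `f i` sends the `R`-thickening of `E` into the `q * R`-thickening, so every preimage in the
invariance identity has full mass. Iteration concentrates `μ` on `E`. -/
lemma cthickening_eq_one (hf : IsSimilitudeSystem f r) (hE : IsSelfSimilarSet f E)
    (hdim : ∑ i, r i ^ s = 1) (hμ : IsNaturalMeasure f r s μ) {q R : ℝ} (hq : ∀ i, r i ≤ q)
    (hR : 0 ≤ R) (h : μ (Metric.cthickening R E) = 1) (hq0 : 0 ≤ q) :
    μ (Metric.cthickening (q * R) E) = 1 := by
  have := hμ.isProbabilityMeasure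
  refine le_antisymm prob_le_one ?_
  rw [hμ.apply hf Metric.isClosed_cthickening.measurableSet, ← sum_ofReal_rpow_eq_one hf hdim]
  refine Finset.sum_le_sum fun i _ => le_mul_of_one_le_right' ?_
  rw [← h]
  refine measure_mono fun x hx => ?_
  rw [hE.isCompact.cthickening_eq_biUnion_closedBall hR] at hx
  obtain ⟨y, hy, hxy⟩ := mem_iUnion₂.1 hx
  refine Metric.mem_cthickening_of_dist_le _ (f i y) _ _ (hE.mapsTo i hy) ?_
  rw [(hf i).2.2]
  exact mul_le_mul (hq i) hxy dist_nonneg hq0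

lemma measure_compl (hf : IsSimilitudeSystem f r) (hE : IsSelfSimilarSet f E)
    (hdim : ∑ i, r i ^ s = 1) (hμ : IsNaturalMeasure f r s μ) : μ Eᶜ = 0 := by
  have := hμ.isProbabilityMeasure
  obtain ⟨K, hK, hK0⟩ := hμ.compactly_supported
  obtain ⟨_, q, _, _, hq0, hq1, hq⟩ := hf.exists_bounds
  obtain ⟨x0, hx0⟩ := hE.nonempty
  obtain ⟨R, hR0, hR⟩ : ∃ R : ℝ, 0 < R ∧ K ⊆ Metric.closedBall x0 R := by
    obtain ⟨R, hR⟩ := hK.isBounded.subset_closedBall x0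
    exact ⟨max R 1, by positivity, hR.trans (Metric.closedBall_subset_closedBall (le_max_left _ _))⟩
  have h0 : μ (Metric.cthickening R E) = 1 := by
    refine le_antisymm prob_le_one ?_
    rw [← (prob_compl_eq_zero_iff hK.measurableSet).1 hK0]
    exact measure_mono (hR.trans (Metric.closedBall_subset_cthickening hx0 R))
  have hk (k : ℕ) : μ (Metric.cthickening (q ^ k * R) E) = 1 := by
    induction k with
    | zero => simpa using h0
    | succ k ih =>
      rw [pow_succ', mul_assoc]
      exact hμ.cthickening_eq_one hf hE hdim (fun i => (hq i).2) (by positivity) ih hq0.le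
  rw [prob_compl_eq_zero_iff hE.isCompact.measurableSet]
  have hlim : Tendsto (fun k : ℕ => q ^ k * R) atTop (𝓝 0) := by
    simpa using (tendsto_pow_atTop_nhds_zero_of_lt_one hq0.le hq1).mul_const R
  have := (tendsto_measure_cthickening_of_isClosed (μ := μ) ⟨1, one_pos, measure_ne_top _ _⟩
    hE.isCompact.isClosed).comp hlim
  exact tendsto_nhds_unique this (by simp [Function.comp_def, hk])

lemma measure_eq_one (hf : IsSimilitudeSystem f r) (hE : IsSelfSimilarSet f E)
    (hdim : ∑ i, r i ^ s = 1) (hμ : IsNaturalMeasure f r s μ) : μ E = 1 :=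
  have := hμ.isProbabilityMeasure
  (prob_compl_eq_zero_iff hE.isCompact.measurableSet).1 (hμ.measure_compl hf hE hdim)

/-- A forward invariant set that contains a cylinder has full measure. -/
lemma eq_one_of_invariant (hf : IsSimilitudeSystem f r) (hE : IsSelfSimilarSet f E)
    (hdim : ∑ i, r i ^ s = 1) (hμ : IsNaturalMeasure f r s μ)
    {A : Set (EuclideanSpace ℝ (Fin n))} (hA : MeasurableSet A) (hfA : ∀ i, f i '' A ⊆ A)
    {u : List (Fin m)} (hu : wordMap f u '' E ⊆ A) : μ A = 1 := by
  have := hμ.isProbabilityMeasure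
  have hN := hA.compl
  have hfN (i : Fin m) : f i ⁻¹' Aᶜ ⊆ Aᶜ := fun x hx hxA => hx (hfA i (mem_image_of_mem _ hxA))
  have hsplit (i : Fin m) : μ (f i ⁻¹' Aᶜ) + μ (Aᶜ \ f i ⁻¹' Aᶜ) = μ Aᶜ := by
    have := measure_sdiff_add_inter (μ := μ) Aᶜ (hf.measurable i hN)
    rwa [inter_eq_self_of_subset_right (hfN i), add_comm] at this
  -- By invariance `μ Aᶜ` is a weighted mean of the masses of the preimages of `Aᶜ`. These lie in
  -- `Aᶜ`, and all weights are positive, so none of them loses mass.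
  have step (i : Fin m) : μ (Aᶜ \ f i ⁻¹' Aᶜ) = 0 := by
    have h : μ Aᶜ + ∑ i, ENNReal.ofReal (r i ^ s) * μ (Aᶜ \ f i ⁻¹' Aᶜ) = μ Aᶜ := by
      conv_lhs => rw [hμ.apply hf hN]
      rw [← Finset.sum_add_distrib]
      simp_rw [← mul_add]
      simp_rw [hsplit]
      rw [← Finset.sum_mul, sum_ofReal_rpow_eq_one hf hdim, one_mul]
    have h0 : ∑ i, ENNReal.ofReal (r i ^ s) * μ (Aᶜ \ f i ⁻¹' Aᶜ) = 0 :=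
      (ENNReal.add_right_inj (measure_ne_top μ Aᶜ)).1 (by rw [h, add_zero])
    have := (Finset.sum_eq_zero_iff.1 h0) i (Finset.mem_univ i)
    exact (mul_eq_zero.1 this).resolve_left
      (ENNReal.ofReal_pos.2 (Real.rpow_pos_of_pos (hf i).1 _)).ne'
  have pull (w : List (Fin m)) {B : Set (EuclideanSpace ℝ (Fin n))} (hB : MeasurableSet B)
      (h0 : μ B = 0) : μ (wordMap f w ⁻¹' B) = 0 := by
    have := hμ.le_wordMap hf hB w
    rw [h0, nonpos_iff_eq_zero, mul_eq_zero] at this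
    exact this.resolve_left
      (ENNReal.ofReal_pos.2 (Real.rpow_pos_of_pos (hf.wordRatio_pos w) _)).ne'
  have key (w : List (Fin m)) : μ (Aᶜ \ wordMap f w ⁻¹' Aᶜ) = 0 := by
    induction w with
    | nil => simp [wordMap]
    | cons i w ih =>
      refine measure_mono_null (t := (Aᶜ \ wordMap f w ⁻¹' Aᶜ) ∪
        wordMap f w ⁻¹' (Aᶜ \ f i ⁻¹' Aᶜ)) (fun x hx => ?_)
        (measure_union_null ih (pull w (hN.diff (hf.measurable i hN)) (step i)))
      by_cases h : wordMap f w x ∈ Aᶜ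
      · exact Or.inr ⟨h, hx.2⟩
      · exact Or.inl ⟨hx.1, h⟩
  rw [← prob_compl_eq_zero_iff hA]
  -- All of `E` is sent into `A` by `wordMap f u`, so `Aᶜ ∩ E` misses the preimage of `Aᶜ`.
  refine measure_mono_null (t := (Aᶜ \ wordMap f u ⁻¹' Aᶜ) ∪ Eᶜ) (fun x hx => ?_)
    (measure_union_null (key u) (hμ.measure_compl hf hE hdim))
  by_cases h : x ∈ E
  · exact Or.inl ⟨hx, fun h' => h' (hu (mem_image_of_mem _ h))⟩
  · exact Or.inr h

end IsNaturalMeasure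

lemma IsSelfSimilarSet.exists_word_subset (hf : IsSimilitudeSystem f r)
    (hE : IsSelfSimilarSet f E) {x : EuclideanSpace ℝ (Fin n)} (hx : x ∈ E) {ε : ℝ}
    (hε : 0 < ε) : ∃ w : List (Fin m), x ∈ wordMap f w '' E ∧
      ∀ y ∈ wordMap f w '' E, dist y x ≤ ε := by
  obtain ⟨p, q, hp0, hp1, hq0, hq1, hpq⟩ := hf.exists_bounds
  obtain ⟨D, hD1, hD⟩ := hE.exists_bound
  obtain ⟨w, hw, -, hwη⟩ := hE.exists_word hf hp1 (fun i => (hpq i).1) hx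
    (η := min 1 (ε / D)) (by positivity) (min_le_left _ _)
  refine ⟨w, hw, ?_⟩
  obtain ⟨x, hxE, rfl⟩ := hw
  rintro _ ⟨y, hy, rfl⟩
  rw [hf.dist_wordMap]
  calc wordRatio r w * dist y x ≤ ε / D * D := by
        gcongr
        · exact hwη.trans (min_le_right _ _)
        · exact hD y hy x hxE
    _ = ε := by field_simp

namespace IsNaturalMeasure

lemma feasible_eq_one (hf : IsSimilitudeSystem f r) (hE : IsSelfSimilarSet f E)
    (hdim : ∑ i, r i ^ s = 1) (hμ : IsNaturalMeasure f r s μ) (hO : IsFeasible f E O) :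
    μ O = 1 := by
  obtain ⟨x, hxO, hxE⟩ := hO.inter_nonempty
  obtain ⟨ε, hε, hεO⟩ := Metric.isOpen_iff.1 hO.isOpen x hxO
  obtain ⟨w, -, hw⟩ := hE.exists_word_subset hf hxE (half_pos hε)
  exact hμ.eq_one_of_invariant hf hE hdim hO.isOpen.measurableSet hO.image_subset (u := w)
    fun y hy => hεO ((hw y hy).trans_lt (half_lt_self hε))

/-- Only the `i`-th term of the invariance identity survives: for `j ≠ i` the preimage of `f i '' A`
under `f j` misses `O`, which has full measure. This turns the open set condition into exact
scaling. -/
lemma image_eq (hf : IsSimilitudeSystem f r) (hE : IsSelfSimilarSet f E)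
    (hdim : ∑ i, r i ^ s = 1) (hμ : IsNaturalMeasure f r s μ) (hO : IsFeasible f E O)
    {A : Set (EuclideanSpace ℝ (Fin n))} (hA : IsCompact A) (hAO : A ⊆ O) (i : Fin m) :
    μ (f i '' A) = ENNReal.ofReal (r i ^ s) * μ A := by
  have := hμ.isProbabilityMeasure
  rw [hμ.apply hf (hA.image (hf.continuous i)).measurableSet, Finset.sum_eq_single i,
    preimage_image_eq _ (hf.injective i)]
  · intro j _ hji
    rw [mul_eq_zero]
    right
    refine measure_mono_null (t := Oᶜ) ?_ ((prob_compl_eq_zero_iff hO.isOpen.measurableSet).2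
      (hμ.feasible_eq_one hf hE hdim hO))
    intro x hx hxO
    exact (hO.disjoint j i hji).le_bot ⟨mem_image_of_mem _ hxO, image_mono hAO hx⟩
  · simp

lemma image_wordMap_eq (hf : IsSimilitudeSystem f r) (hE : IsSelfSimilarSet f E)
    (hdim : ∑ i, r i ^ s = 1) (hμ : IsNaturalMeasure f r s μ) (hO : IsFeasible f E O)
    {A : Set (EuclideanSpace ℝ (Fin n))} (hA : IsCompact A) (hAO : A ⊆ O) (w : List (Fin m)) :
    wordMap f w '' A ⊆ O ∧
      μ (wordMap f w '' A) = ENNReal.ofReal (wordRatio r w ^ s) * μ A := by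
  induction w with
  | nil => simpa [wordMap, wordRatio] using hAO
  | cons i w ih =>
    rw [wordMap, image_comp, wordRatio, Real.mul_rpow (hf i).1.le (hf.wordRatio_pos w).le,
      ENNReal.ofReal_mul (Real.rpow_nonneg (hf i).1.le _), mul_assoc, ← ih.2]
    exact ⟨(image_mono ih.1).trans (hO.image_subset i),
      hμ.image_eq hf hE hdim hO (hA.image (hf.continuous_wordMap w)) ih.1 i⟩

/-- Densities of balls inside a feasible open set are invariant under the system. -/
lemma density_wordMap (hf : IsSimilitudeSystem f r) (hE : IsSelfSimilarSet f E) (hs : 0 < s)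
    (hdim : ∑ i, r i ^ s = 1) (hμ : IsNaturalMeasure f r s μ) (hO : IsFeasible f E O)
    {x : EuclideanSpace ℝ (Fin n)} {d : ℝ} (hx : Metric.closedBall x d ⊆ O)
    (w : List (Fin m)) :
    density (fun A => μ A) s (wordMap f w x) (wordRatio r w * d) =
      density (fun A => μ A) s x d := by
  have hw := hf.wordRatio_pos w
  simp only [density]
  rw [← hf.image_wordMap_closedBall w x d,
    (hμ.image_wordMap_eq hf hE hdim hO (isCompact_closedBall x d) hx w).2, mul_left_comm,
    ENNReal.ofReal_mul hw.le, ENNReal.mul_rpow_of_nonneg _ _ hs.le,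
    ENNReal.ofReal_rpow_of_pos hw]
  have h := Real.rpow_pos_of_pos hw s
  exact ENNReal.mul_div_mul_left _ _ (ENNReal.ofReal_pos.2 h).ne' ENNReal.ofReal_ne_top

/-- The lower Ahlfors bound. -/
lemma exists_lower_bound (hf : IsSimilitudeSystem f r) (hE : IsSelfSimilarSet f E) (hs : 0 < s)
    (hdim : ∑ i, r i ^ s = 1) (hμ : IsNaturalMeasure f r s μ) :
    ∃ c : ℝ≥0∞, c ≠ 0 ∧ c ≠ ∞ ∧ ∀ x ∈ E, ∀ d : ℝ, 0 < d → d ≤ 1 →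
      c * ENNReal.ofReal (2 * d) ^ s ≤ μ (Metric.closedBall x d) := by
  obtain ⟨p, q, hp0, hp1, hq0, hq1, hpq⟩ := hf.exists_bounds
  obtain ⟨D, hD1, hD⟩ := hE.exists_bound
  have hD0 : 0 < D := one_pos.trans_le hD1
  -- The ball contains a whole cylinder of ratio at least `p * d / D`; the `2` converts `d` into `2
  -- * d`.
  refine ⟨ENNReal.ofReal (p / (2 * D)) ^ s, (ENNReal.rpow_pos (by positivity) (by simp)).ne',
    ENNReal.rpow_ne_top_of_nonneg hs.le (by simp), fun x hx d hd hd1 => ?_⟩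
  obtain ⟨w, ⟨x, hxE, rfl⟩, hw1, hw2⟩ := hE.exists_word hf hp1 (fun i => (hpq i).1) hx
    (η := d / D) (by positivity) ((div_le_one hD0).2 (hd1.trans hD1))
  refine le_trans ?_ (hμ.le_wordMap hf Metric.isClosed_closedBall.measurableSet w)
  have h1 : μ (wordMap f w ⁻¹' Metric.closedBall (wordMap f w x) d) = 1 := by
    have := hμ.isProbabilityMeasure
    refine le_antisymm prob_le_one ?_
    rw [← hμ.measure_eq_one hf hE hdim]
    refine measure_mono fun y hy => ?_
    rw [mem_preimage, Metric.mem_closedBall, hf.dist_wordMap]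
    calc wordRatio r w * dist y x ≤ d / D * D := by gcongr; exact hD y hy x hxE
      _ = d := by field_simp
  rw [h1, mul_one, ← ENNReal.mul_rpow_of_nonneg _ _ hs.le, ← ENNReal.ofReal_mul (by positivity),
    ENNReal.ofReal_rpow_of_pos (by positivity)]
  gcongr
  refine le_trans (le_of_eq ?_) hw1
  field_simp

/-- The volume comparison behind the upper Ahlfors bound, for a similar copy `g` of the system
at scale `t ≥ p * R`. -/
lemma preimage_le_volume (hf : IsSimilitudeSystem f r) (hE : IsSelfSimilarSet f E) (hs : 0 < s)
    (hdim : ∑ i, r i ^ s = 1) (hμ : IsNaturalMeasure f r s μ) (hO : IsFeasible f E O)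
    {p q D ρ : ℝ} (hp0 : 0 < p) (hq0 : 0 < q) (hpq : ∀ i, p ≤ r i ∧ r i ≤ q)
    (hD : ∀ x ∈ E, ∀ y ∈ E, dist x y ≤ D) (hρ : 0 < ρ)
    {x₀ : EuclideanSpace ℝ (Fin n)} (hx₀ : x₀ ∈ E) (hx₀O : Metric.ball x₀ ρ ⊆ O)
    {x : EuclideanSpace ℝ (Fin n)} {R : ℝ} (hR : 0 < R) (k : ℕ) :
    ∀ (g : EuclideanSpace ℝ (Fin n) → EuclideanSpace ℝ (Fin n)) (t : ℝ), 0 < t →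
      Function.Surjective g → (∀ y z, dist (g y) (g z) = t * dist y z) → p * R ≤ t →
      t * q ^ k ≤ R →
      ENNReal.ofReal (t ^ s) * μ (g ⁻¹' Metric.closedBall x R) *
          volume (Metric.ball (0 : EuclideanSpace ℝ (Fin n)) (p * R * ρ)) ≤
        ENNReal.ofReal (R ^ s) * volume (Metric.ball x ((1 + D + ρ) * R) ∩ g '' O) := by
  have := hμ.isProbabilityMeasure
  -- At scale `t ≤ R`, if `g '' E` meets the ball, then `g '' O` contains a ball of radius `p * R *
  -- ρ` near `x`. Otherwise the left side vanishes.
  have hbase : ∀ (g : EuclideanSpace ℝ (Fin n) → EuclideanSpace ℝ (Fin n)) (t : ℝ), 0 < t →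
      Function.Surjective g → (∀ y z, dist (g y) (g z) = t * dist y z) → p * R ≤ t → t ≤ R →
      ENNReal.ofReal (t ^ s) * μ (g ⁻¹' Metric.closedBall x R) *
          volume (Metric.ball (0 : EuclideanSpace ℝ (Fin n)) (p * R * ρ)) ≤
        ENNReal.ofReal (R ^ s) * volume (Metric.ball x ((1 + D + ρ) * R) ∩ g '' O) := by
    intro g t ht hg hgd hpt htR
    by_cases hemp : ∃ y ∈ E, g y ∈ Metric.closedBall x R
    · obtain ⟨y, hy, hyx⟩ := hemp
      refine mul_le_mul' ?_ ?_
      · calc ENNReal.ofReal (t ^ s) * μ (g ⁻¹' Metric.closedBall x R)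
            ≤ ENNReal.ofReal (R ^ s) * 1 := by gcongr; exact prob_le_one
          _ = _ := mul_one _
      · rw [← Measure.addHaar_ball_center volume (g x₀)]
        refine measure_mono fun z hz => ?_
        obtain ⟨z, rfl⟩ := hg z
        rw [Metric.mem_ball, hgd] at hz
        have hz' : dist z x₀ < ρ := by
          refine lt_of_mul_lt_mul_left (hz.trans_le ?_) ht.le
          gcongr
        refine ⟨?_, mem_image_of_mem _ (hx₀O hz')⟩
        rw [Metric.mem_ball]
        have h1 : dist (g z) (g x₀) < R * ρ := by
          rw [hgd]
          calc t * dist z x₀ < t * ρ := by gcongr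
            _ ≤ R * ρ := by gcongr
        have h2 : dist (g x₀) (g y) ≤ R * D := by
          rw [hgd]
          exact mul_le_mul htR (hD x₀ hx₀ y hy) dist_nonneg hR.le
        have h3 := Metric.mem_closedBall.1 hyx
        have := dist_triangle4 (g z) (g x₀) (g y) x
        nlinarith
    · have h0 : μ (g ⁻¹' Metric.closedBall x R) = 0 :=
        measure_mono_null (fun y hy hyE => hemp ⟨y, hyE, hy⟩) (hμ.measure_compl hf hE hdim)
      rw [h0]
      simp
  induction k with
  | zero => exact fun g t ht hg hgd hpt htR => hbase g t ht hg hgd hpt (by simpa using htR)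
  | succ k ih =>
    intro g t ht hg hgd hpt htR
    rcases le_or_gt t R with h | h
    · exact hbase g t ht hg hgd hpt h
    have hgc : Continuous g := (LipschitzWith.of_dist_le_mul (K := t.toNNReal) fun y z => by
      rw [hgd, Real.coe_toNNReal _ ht.le]).continuous
    have hgi : Function.Injective g := fun y z hyz => by
      have := hgd y z
      rw [hyz, dist_self] at this
      exact dist_eq_zero.1 ((mul_eq_zero.1 this.symm).resolve_left ht.ne')
    have hme : MeasurableEmbedding g := hgc.measurableEmbedding hgi
    have hmo (i : Fin m) : MeasurableSet ((g ∘ f i) '' O) :=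
      ((hgc.comp (hf.continuous i)).measurableEmbedding
        (hgi.comp (hf.injective i))).measurableSet_image.2 hO.isOpen.measurableSet
    -- For `t > R` the copy splits into the copies `g ∘ f i`, still of scale at least `p * R`. Their
    -- images of `O` are disjoint subsets of `g '' O`, so the volumes add up.
    calc ENNReal.ofReal (t ^ s) * μ (g ⁻¹' Metric.closedBall x R) *
          volume (Metric.ball (0 : EuclideanSpace ℝ (Fin n)) (p * R * ρ))
        = ∑ i, ENNReal.ofReal ((t * r i) ^ s) * μ ((g ∘ f i) ⁻¹' Metric.closedBall x R) *
          volume (Metric.ball (0 : EuclideanSpace ℝ (Fin n)) (p * R * ρ)) := by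
          rw [hμ.apply hf (hgc.measurable Metric.isClosed_closedBall.measurableSet),
            ← Finset.sum_mul, Finset.mul_sum]
          congr 1
          refine Finset.sum_congr rfl fun i _ => ?_
          rw [Real.mul_rpow ht.le (hf i).1.le, ENNReal.ofReal_mul (by positivity), mul_assoc]
          rfl
      _ ≤ ∑ i, ENNReal.ofReal (R ^ s) *
            volume (Metric.ball x ((1 + D + ρ) * R) ∩ (g ∘ f i) '' O) := by
          refine Finset.sum_le_sum fun i _ => ?_
          have hr := (hf i).1
          refine ih (g ∘ f i) (t * r i) (by positivity) (hg.comp (hf.surjective i))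
            (fun y z => by simp [hgd, (hf i).2.2, mul_assoc]) ?_ ?_
          · nlinarith [(hpq i).1]
          · refine le_trans ?_ htR
            rw [pow_succ', ← mul_assoc]
            gcongr
            exact (hpq i).2
      _ = ENNReal.ofReal (R ^ s) *
            volume (⋃ i, Metric.ball x ((1 + D + ρ) * R) ∩ (g ∘ f i) '' O) := by
          rw [← Finset.mul_sum, measure_iUnion, tsum_fintype]
          · intro i j hij
            refine Disjoint.mono inter_subset_right inter_subset_right ?_
            rw [image_comp, image_comp]
            exact (disjoint_image_iff hgi).2 (hO.disjoint i j hij)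
          · exact fun i => Metric.isOpen_ball.measurableSet.inter (hmo i)
      _ ≤ _ := by
          gcongr
          refine iUnion_subset fun i => inter_subset_inter_right _ ?_
          rw [image_comp]
          exact image_mono (hO.image_subset i)

/-- The upper Ahlfors bound. -/
lemma exists_upper_bound (hf : IsSimilitudeSystem f r) (hE : IsSelfSimilarSet f E) (hs : 0 < s)
    (hdim : ∑ i, r i ^ s = 1) (hμ : IsNaturalMeasure f r s μ) (hO : IsFeasible f E O) :
    ∃ c : ℝ≥0∞, c ≠ 0 ∧ c ≠ ∞ ∧ ∀ x : EuclideanSpace ℝ (Fin n), ∀ d : ℝ, 0 < d → d ≤ 1 →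
      μ (Metric.closedBall x d) ≤ c * ENNReal.ofReal (2 * d) ^ s := by
  obtain ⟨p, q, hp0, hp1, hq0, hq1, hpq⟩ := hf.exists_bounds
  obtain ⟨D, hD1, hD⟩ := hE.exists_bound
  obtain ⟨x₀, hx₀O, hx₀⟩ := hO.inter_nonempty
  obtain ⟨ρ, hρ, hρO⟩ := Metric.isOpen_iff.1 hO.isOpen x₀ hx₀O
  -- Ratio of the radii of the enclosing ball and of the small balls; its `n`-th power is the volume
  -- ratio.
  set L := (1 + D + ρ) / (p * ρ) with hL
  have hL0 : 0 < L := by positivity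
  refine ⟨ENNReal.ofReal (L ^ n), (by positivity), by simp, fun x d hd hd1 => ?_⟩
  obtain ⟨k, hk⟩ := exists_pow_lt_of_lt_one hd hq1
  have h := hμ.preimage_le_volume hf hE hs hdim hO hp0 hq0 hpq hD hρ hx₀ hρO (x := x) hd k id 1
    one_pos Function.surjective_id (by simp) (by nlinarith) (by simpa using hk.le)
  have hv : volume (Metric.ball x ((1 + D + ρ) * d)) = ENNReal.ofReal (L ^ n) *
      volume (Metric.ball (0 : EuclideanSpace ℝ (Fin n)) (p * d * ρ)) := by
    rw [show (1 + D + ρ) * d = L * (p * d * ρ) by rw [hL]; field_simp,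
      Measure.addHaar_ball_mul_of_pos _ _ hL0]
    simp
  have hb0 : volume (Metric.ball (0 : EuclideanSpace ℝ (Fin n)) (p * d * ρ)) ≠ 0 :=
    (Metric.measure_ball_pos _ _ (by positivity)).ne'
  have hb1 : volume (Metric.ball (0 : EuclideanSpace ℝ (Fin n)) (p * d * ρ)) ≠ ∞ :=
    measure_ball_lt_top.ne
  simp only [Real.one_rpow, ENNReal.ofReal_one, one_mul, preimage_id] at h
  have h2 := h.trans (mul_le_mul_right (measure_mono inter_subset_left) _)
  rw [hv, ← mul_assoc, ENNReal.mul_le_mul_iff_left hb0 hb1, mul_comm] at h2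
  refine h2.trans ?_
  rw [← ENNReal.ofReal_rpow_of_pos hd]
  gcongr
  linarith

end IsNaturalMeasure

/-! ### Generic points -/

/-- The points having addresses in which every finite word occurs arbitrarily late. -/
def richPoints (f : Fin m → EuclideanSpace ℝ (Fin n) → EuclideanSpace ℝ (Fin n))
    (E : Set (EuclideanSpace ℝ (Fin n))) : Set (EuclideanSpace ℝ (Fin n)) :=
  ⋂ (v : List (Fin m)) (k : ℕ), ⋃ (w : List (Fin m)) (_ : k ≤ w.length),
    wordMap f w '' (wordMap f v '' E)

lemma measurableSet_richPoints_aux (hf : IsSimilitudeSystem f r) (hE : IsSelfSimilarSet f E)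
    (v : List (Fin m)) (k : ℕ) : MeasurableSet (⋃ (w : List (Fin m)) (_ : k ≤ w.length),
    wordMap f w '' (wordMap f v '' E)) :=
  MeasurableSet.iUnion fun w => MeasurableSet.iUnion fun _ =>
    ((hE.isCompact.image (hf.continuous_wordMap v)).image
      (hf.continuous_wordMap w)).measurableSet

lemma measurableSet_richPoints (hf : IsSimilitudeSystem f r) (hE : IsSelfSimilarSet f E) :
    MeasurableSet (richPoints f E) :=
  MeasurableSet.iInter fun v => MeasurableSet.iInter fun k =>
    measurableSet_richPoints_aux hf hE v k

namespace IsNaturalMeasure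

/-- For fixed `v` and `k` the set is stable under prefixing letters and contains the cylinder of `k`
arbitrary letters followed by `v`, so it has full measure. There are countably many pairs. -/
lemma richPoints_mem_ae (hf : IsSimilitudeSystem f r) (hE : IsSelfSimilarSet f E)
    (hdim : ∑ i, r i ^ s = 1) (hμ : IsNaturalMeasure f r s μ) : richPoints f E ∈ ae μ := by
  have := hμ.isProbabilityMeasure
  obtain ⟨i⟩ : Nonempty (Fin m) := by
    by_contra h
    rw [not_nonempty_iff] at h
    simp at hdim
  refine countable_iInter_mem.2 fun v => countable_iInter_mem.2 fun k => ?_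
  rw [mem_ae_iff_prob_eq_one (measurableSet_richPoints_aux hf hE v k)]
  refine hμ.eq_one_of_invariant hf hE hdim (measurableSet_richPoints_aux hf hE v k)
    (u := List.replicate k i ++ v) ?_ ?_
  · rintro j _ ⟨x, hx, rfl⟩
    obtain ⟨w, hw, y, hy, rfl⟩ := mem_iUnion₂.1 hx
    exact mem_iUnion₂.2 ⟨j :: w, by simp; omega, y, hy, rfl⟩
  · rintro _ ⟨x, hx, rfl⟩
    exact mem_iUnion₂.2 ⟨List.replicate k i, by simp, _, mem_image_of_mem _ hx,
      (wordMap_append f _ _ _).symm⟩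

/-- The density of a typical ball belongs to the spectrum at every rich point. -/
lemma density_mem_Spec (hf : IsSimilitudeSystem f r) (hE : IsSelfSimilarSet f E) (hs : 0 < s)
    (hdim : ∑ i, r i ^ s = 1) (hμ : IsNaturalMeasure f r s μ)
    {x y : EuclideanSpace ℝ (Fin n)} {d : ℝ} (hx : IsTypicalBall f E x d)
    (hy : y ∈ richPoints f E) : density (fun A => μ A) s x d ∈ Spec (fun A => μ A) s {y} := by
  have := hμ.isProbabilityMeasure
  obtain ⟨p, q, hp0, hp1, hq0, hq1, hpq⟩ := hf.exists_bounds
  obtain ⟨hxE, hd, O, hO, hxO⟩ := hx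
  obtain ⟨ε, hε, hεO⟩ := (isCompact_closedBall x d).exists_cthickening_subset_open hO.isOpen hxO
  rw [cthickening_closedBall hε.le hd.le] at hεO
  -- Radii are enlarged by `η k` so that the ball at the displaced centre `z` still contains
  -- `closedBall x d`. Since `2 * η k ≤ ε`, it also stays inside the feasible set.
  set η : ℕ → ℝ := fun k => ε / 2 * (1 / ((k : ℝ) + 1)) with hη
  have hη0 (k : ℕ) : 0 < η k := by positivity
  have hηε (k : ℕ) : η k ≤ ε / 2 :=
    mul_le_of_le_one_right (by positivity)
      ((div_le_one (by positivity)).2 (by linarith [k.cast_nonneg (α := ℝ)]))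
  have hηlim : Tendsto η atTop (𝓝 0) := by
    simpa [hη] using tendsto_one_div_add_atTop_nhds_zero_nat.const_mul (ε / 2)
  have key (k : ℕ) : ∃ e : ℝ, 0 < e ∧ e ≤ q ^ k * (d + ε) ∧
      ∃ z, Metric.closedBall x d ⊆ Metric.closedBall z (d + η k) ∧
        Metric.closedBall z (d + η k) ⊆ Metric.cthickening (2 * η k) (Metric.closedBall x d) ∧
        density (fun A => μ A) s y e = density (fun A => μ A) s z (d + η k) := by
    obtain ⟨v, -, hv⟩ := hE.exists_word_subset hf hxE (hη0 k)
    -- Richness gives `y` as the image, under a word of length at least `k`, of a point `z` within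
    -- `η k` of `x`.
    obtain ⟨w, hw, z, hz, rfl⟩ := mem_iUnion₂.1 (mem_iInter₂.1 hy v k)
    have hzx := hv z hz
    have hsub : Metric.closedBall z (d + η k) ⊆ Metric.closedBall x (2 * η k + d) :=
      Metric.closedBall_subset_closedBall' (by linarith)
    refine ⟨wordRatio r w * (d + η k), mul_pos (hf.wordRatio_pos w) (by linarith [hη0 k]), ?_, z,
      Metric.closedBall_subset_closedBall' (by rw [dist_comm]; linarith), ?_, ?_⟩
    · have h1 := (hf.wordRatio_le_pow (fun i => (hpq i).2) w).trans
        (pow_le_pow_of_le_one hq0.le hq1.le hw)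
      have h2 := hηε k
      have h3 := hη0 k
      exact mul_le_mul h1 (by linarith) (by linarith) (by positivity)
    · rwa [cthickening_closedBall (by linarith [hη0 k]) hd.le]
    · refine hμ.density_wordMap hf hE hs hdim hO (hsub.trans (le_trans ?_ hεO)) w
      exact Metric.closedBall_subset_closedBall (by linarith [hηε k])
  choose e he0 heq z hz1 hz2 hez using key
  refine ⟨y, rfl, e, he0, ?_, ?_⟩
  · refine squeeze_zero (fun k => (he0 k).le) heq ?_
    simpa using (tendsto_pow_atTop_nhds_zero_of_lt_one hq0.le hq1).mul_const (d + ε)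
  · have hden : Tendsto (fun k => ENNReal.ofReal (2 * (d + η k)) ^ s) atTop
        (𝓝 (ENNReal.ofReal (2 * d) ^ s)) := by
      refine (ENNReal.continuous_rpow_const.tendsto _).comp (ENNReal.tendsto_ofReal ?_)
      simpa using (tendsto_const_nhds (x := d)).add hηlim |>.const_mul 2
    have hnum : Tendsto (fun k => μ (Metric.cthickening (2 * η k) (Metric.closedBall x d))) atTop
        (𝓝 (μ (Metric.closedBall x d))) :=
      (tendsto_measure_cthickening_of_isClosed ⟨1, one_pos, measure_ne_top _ _⟩
        Metric.isClosed_closedBall).comp (by simpa using hηlim.const_mul 2)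
    have h0 := ofReal_two_mul_rpow_ne_zero (s := s) hd
    have h1 := ofReal_two_mul_rpow_ne_top (d := d) hs.le
    refine tendsto_of_tendsto_of_tendsto_of_le_of_le
      (ENNReal.Tendsto.div tendsto_const_nhds (Or.inr h0) hden (Or.inl h1))
      (ENNReal.Tendsto.div hnum (Or.inr h0) hden (Or.inl h1)) (fun k => ?_) (fun k => ?_)
    · rw [hez]
      exact ENNReal.div_le_div_right (measure_mono (hz1 k)) _
    · simp only [hez]
      exact ENNReal.div_le_div_right (measure_mono (hz2 k)) _

/-- The spectrum at a rich point of the feasible set is the spectrum of the feasible set. -/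
lemma Spec_singleton_eq (hf : IsSimilitudeSystem f r) (hE : IsSelfSimilarSet f E) (hs : 0 < s)
    (hdim : ∑ i, r i ^ s = 1) (hμ : IsNaturalMeasure f r s μ) (hO : IsFeasible f E O)
    {y : EuclideanSpace ℝ (Fin n)} (hy : y ∈ richPoints f E) (hyO : y ∈ O ∩ E) :
    Spec (fun A => μ A) s {y} = Spec (fun A => μ A) s (O ∩ E) := by
  apply Subset.antisymm
  · rintro L ⟨x, rfl, h⟩
    exact ⟨x, hyO, h⟩
  · rintro L ⟨x, hx, d, hd, hd0, hL⟩
    obtain ⟨ε, hε, hεO⟩ := Metric.nhds_basis_closedBall.mem_iff.1 (hO.isOpen.mem_nhds hx.1)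
    refine (isClosed_Spec_singleton y).mem_of_tendsto hL ?_
    filter_upwards [hd0.eventually (gt_mem_nhds hε)] with k hk
    exact hμ.density_mem_Spec hf hE hs hdim ⟨hx.2, hd k, O, hO,
      (Metric.closedBall_subset_closedBall hk.le).trans hεO⟩ hy

end IsNaturalMeasure

lemma exists_lt_density {α : Set (EuclideanSpace ℝ (Fin n)) → ℝ≥0∞}
    {y : EuclideanSpace ℝ (Fin n)} {c L : ℝ≥0∞} (hL : L ∈ Spec α s {y}) (hc : c < L) {δ : ℝ}
    (hδ : 0 < δ) : ∃ d ∈ Ioo 0 δ, c < density α s y d := by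
  obtain ⟨y, rfl, d, hd, hd0, hL⟩ := hL
  obtain ⟨k, h1, h2⟩ := ((hd0.eventually (gt_mem_nhds hδ)).and
    (hL.eventually (lt_mem_nhds hc))).exists
  exact ⟨d k, ⟨hd k, h1⟩, h2⟩

lemma exists_density_lt {α : Set (EuclideanSpace ℝ (Fin n)) → ℝ≥0∞}
    {y : EuclideanSpace ℝ (Fin n)} {c L : ℝ≥0∞} (hL : L ∈ Spec α s {y}) (hc : L < c) {δ : ℝ}
    (hδ : 0 < δ) : ∃ d ∈ Ioo 0 δ, density α s y d < c := by
  obtain ⟨y, rfl, d, hd, hd0, hL⟩ := hL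
  obtain ⟨k, h1, h2⟩ := ((hd0.eventually (gt_mem_nhds hδ)).and
    (hL.eventually (gt_mem_nhds hc))).exists
  exact ⟨d k, ⟨hd k, h1⟩, h2⟩

/-! ### The centred and packing measures -/

lemma packingPre_empty :
    packingPre s (∅ : Set (EuclideanSpace ℝ (Fin n))) = 0 := by
  have : packingPre s (∅ : Set (EuclideanSpace ℝ (Fin n))) ≤ 0 := by
    refine (iInf₂_le 1 one_pos).trans (iSup₂_le fun T hT => ?_)
    have : T = ∅ := eq_empty_of_forall_notMem fun p hp => hT.2.1 p hp
    subst this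
    simp [ballSum]
  exact nonpos_iff_eq_zero.1 this

section Formulas

variable {a b c : ℝ≥0∞} {Ehat A : Set (EuclideanSpace ℝ (Fin n))} [IsFiniteMeasure μ]

/-- The centred measure when the upper density is almost everywhere equal to `b` and bounds the
densities of small balls in `O`. -/
lemma mul_centredHausdorff_eq (hOo : IsOpen O) (hs : 0 < s) (hb0 : b ≠ 0) (hb : b ≠ ∞)
    (hc0 : c ≠ 0) (hc : c ≠ ∞)
    (hlow : ∀ x ∈ E, ∀ d : ℝ, 0 < d → d ≤ 1 →
      c * ENNReal.ofReal (2 * d) ^ s ≤ μ (Metric.closedBall x d))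
    (hEhat : Ehat ∈ ae μ) (hOae : O ∈ ae μ)
    (hball : ∀ x ∈ O ∩ E, ∀ d, 0 < d → Metric.closedBall x d ⊆ O →
      density (fun A => μ A) s x d ≤ b)
    (hspec : ∀ y ∈ Ehat, b ∈ Spec (fun A => μ A) s {y})
    (hA : MeasurableSet A) (hAE : A ⊆ E) : b * centredHausdorff s A = μ A := by
  apply le_antisymm
  · simp only [centredHausdorff, ENNReal.mul_iSup]
    refine iSup₂_le fun F hF => le_trans ?_ (measure_mono hF.1)
    -- The value `b` is only a limit of densities, so the covering argument runs with `b' < b`.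
    refine ENNReal.mul_le_of_forall_lt fun b' hb' t ht => ?_
    rcases eq_or_ne b' 0 with rfl | hb0'
    · simp
    refine (mul_le_mul_right ht.le b').trans ?_
    refine mul_centredPre_le (G := F ∩ Ehat) hb0' hb'.ne_top inter_subset_left ?_ ?_ hc0 hc ?_
    · intro x hx δ hδ
      obtain ⟨d, hd, h⟩ := exists_lt_density (hspec x hx.2) hb' hδ
      refine ⟨d, hd, ?_⟩
      rw [← ENNReal.le_div_iff_mul_le (Or.inl (ofReal_two_mul_rpow_ne_zero hd.1))
        (Or.inl (ofReal_two_mul_rpow_ne_top hs.le))]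
      exact h.le
    · exact measure_mono_null (fun x hx h => hx.2 ⟨hx.1, h⟩) (mem_ae_iff.1 hEhat)
    · intro x hx δ hδ
      have h : 0 < min (δ / 2) 1 := by positivity
      exact ⟨min (δ / 2) 1, ⟨h, (min_le_left _ _).trans_lt (half_lt_self hδ)⟩,
        hlow x (hAE (hF.1 hx)) _ h (min_le_right _ _)⟩
  · rw [← measure_inter_conull (t := O) (mem_ae_iff.1 hOae)]
    refine le_of_forall_lt fun t ht => ?_
    -- A compact subset of `A ∩ O` has a thickening inside `O`, so one radius bound makes all small
    -- balls centred in it obey the density bound.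
    obtain ⟨K, hKA, hK, hKt⟩ := (hA.inter hOo.measurableSet).exists_lt_isCompact ht
    refine hKt.trans_le ?_
    obtain ⟨δ, hδ, hδO⟩ := hK.exists_cthickening_subset_open hOo (hKA.trans inter_subset_right)
    have hKA' := hKA.trans inter_subset_left
    refine (le_mul_centredPre hb0 hb hδ fun x hx d hd hdδ => ?_).trans
      (mul_le_mul_right (le_iSup₂ (f := fun (F : Set (EuclideanSpace ℝ (Fin n)))
        (_ : F ⊆ A ∧ IsClosed F) => centredPre s F) K ⟨hKA', hK.isClosed⟩) b)
    rw [← ENNReal.div_le_iff (ofReal_two_mul_rpow_ne_zero hd) (ofReal_two_mul_rpow_ne_top hs.le)]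
    exact hball x ⟨(hKA hx).2, hAE (hKA' hx)⟩ d hd
      ((Metric.closedBall_subset_cthickening hx d).trans
        ((Metric.cthickening_mono hdδ K).trans hδO))

/-- The packing measure when the lower density is almost everywhere equal to `a` and bounds the
densities of small balls in `O`. -/
lemma mul_packingMeasure_eq (hEc : IsClosed E) (hOo : IsOpen O) (hs : 0 < s) (ha0 : a ≠ 0)
    (ha : a ≠ ∞) (hc0 : c ≠ 0) (hc : c ≠ ∞)
    (hlow : ∀ x ∈ E, ∀ d : ℝ, 0 < d → d ≤ 1 →
      c * ENNReal.ofReal (2 * d) ^ s ≤ μ (Metric.closedBall x d))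
    (hEhat : Ehat ∈ ae μ) (hOae : O ∈ ae μ)
    (hball : ∀ x ∈ O ∩ E, ∀ d, 0 < d → Metric.closedBall x d ⊆ O →
      a ≤ density (fun A => μ A) s x d)
    (hspec : ∀ y ∈ Ehat, a ∈ Spec (fun A => μ A) s {y})
    (hA : MeasurableSet A) (hAE : A ⊆ E) : a * packingMeasure s A = μ A := by
  apply le_antisymm
  · have key (ε : ℝ≥0∞) (hε : ε ≠ 0) : packingMeasure s A ≤ μ A / a + (ε + ε) / c := by
      -- The sharp constant `a` is available on a compact `K` inside `O`. The rest has mass at most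
      -- `ε` and is covered by countably many balls, on which the crude constant `c` suffices.
      obtain ⟨K, hKA, hK, hKε⟩ := (hA.inter hOo.measurableSet).exists_isCompact_sdiff_lt
        (measure_ne_top μ _) hε
      have hKA' := hKA.trans inter_subset_left
      have hrest : μ (A \ K) ≤ ε := by
        refine le_trans ?_ hKε.le
        rw [← measure_inter_conull (s := A \ K) (t := O)
          (mem_ae_iff.1 hOae)]
        exact measure_mono fun x hx => ⟨⟨hx.1.1, hx.2⟩, hx.1.2⟩
      obtain ⟨t, ρ, htc, -, -, htcov, htsum⟩ :=
        Besicovitch.exists_closedBall_covering_tsum_measure_le μ hε (fun _ => univ) (A \ K)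
          (fun x _ δ hδ => ⟨δ / 2, mem_univ _, half_pos hδ, half_lt_self hδ⟩)
      have hPK : packingPre s K ≤ μ A / a := by
        refine le_trans ?_ (ENNReal.div_le_div_right (measure_mono hKA') a)
        rw [ENNReal.le_div_iff_mul_le (Or.inl ha0) (Or.inl ha), mul_comm]
        obtain ⟨δ, hδ, hδO⟩ :=
          hK.exists_cthickening_subset_open hOo (hKA.trans inter_subset_right)
        refine mul_packingPre_le ha0 ha hK.isClosed hδ fun x hx d hd hdδ => ?_
        rw [← ENNReal.le_div_iff_mul_le (Or.inl (ofReal_two_mul_rpow_ne_zero hd))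
          (Or.inl (ofReal_two_mul_rpow_ne_top hs.le))]
        exact hball x ⟨(hKA hx).2, hAE (hKA' hx)⟩ d hd
          ((Metric.closedBall_subset_cthickening hx d).trans
            ((Metric.cthickening_mono hdδ K).trans hδO))
      have hPB (x : EuclideanSpace ℝ (Fin n)) (d : ℝ) :
          packingPre s (Metric.closedBall x d ∩ E) ≤ μ (Metric.closedBall x d) / c := by
        refine le_trans ?_ (ENNReal.div_le_div_right (measure_mono (inter_subset_left (t := E))) c)
        rw [ENNReal.le_div_iff_mul_le (Or.inl hc0) (Or.inl hc), mul_comm]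
        exact mul_packingPre_le hc0 hc (Metric.isClosed_closedBall.inter hEc) one_pos
          fun z hz d hd hd1 => hlow z hz.2 d hd hd1
      have := htc.to_subtype
      have := Encodable.ofCountable t
      let B : ℕ → Set (EuclideanSpace ℝ (Fin n)) := fun k => ⋃ x ∈ Encodable.decode₂ t k,
        Metric.closedBall (x : EuclideanSpace ℝ (Fin n)) (ρ x) ∩ E
      let F : ℕ → Set (EuclideanSpace ℝ (Fin n)) := fun k => Nat.casesOn k K B
      have hF : (∀ i, IsClosed (F i)) ∧ A ⊆ ⋃ i, F i := by
        constructor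
        · rintro (_ | k)
          · exact hK.isClosed
          · exact Encodable.iUnion_decode₂_cases (C := IsClosed) isClosed_empty
              fun x => Metric.isClosed_closedBall.inter hEc
        · intro x hx
          by_cases hxK : x ∈ K
          · exact mem_iUnion.2 ⟨0, hxK⟩
          · obtain ⟨y, hy, hxy⟩ := mem_iUnion₂.1 (htcov ⟨hx, hxK⟩)
            refine mem_iUnion.2 ⟨Encodable.encode (⟨y, hy⟩ : t) + 1, ?_⟩
            exact mem_iUnion₂.2 ⟨⟨y, hy⟩, by simp, hxy, hAE hx⟩
      refine (iInf₂_le F hF).trans ?_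
      rw [tsum_eq_zero_add' ENNReal.summable]
      refine add_le_add hPK ?_
      calc ∑' k, packingPre s (F (k + 1))
          = ∑' x : t, packingPre s
              (Metric.closedBall (x : EuclideanSpace ℝ (Fin n)) (ρ x) ∩ E) := by
            exact tsum_iUnion_decode₂ (packingPre s) packingPre_empty _
        _ ≤ ∑' x : t, μ (Metric.closedBall (x : EuclideanSpace ℝ (Fin n)) (ρ x)) / c :=
            ENNReal.tsum_le_tsum fun x => hPB _ _
        _ = (∑' x : t, μ (Metric.closedBall (x : EuclideanSpace ℝ (Fin n)) (ρ x))) / c := by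
            simp only [div_eq_mul_inv, ENNReal.tsum_mul_right]
        _ ≤ (ε + ε) / c := ENNReal.div_le_div_right (htsum.trans (by gcongr)) c
    rw [mul_comm, ← ENNReal.le_div_iff_mul_le (Or.inl ha0) (Or.inl ha)]
    have hlim : Tendsto (fun ε : ℝ≥0∞ => μ A / a + (ε + ε) / c) (𝓝[>] 0) (𝓝 (μ A / a)) := by
      have h1 : Tendsto (fun ε : ℝ≥0∞ => ε) (𝓝[>] 0) (𝓝 0) := nhdsWithin_le_nhds
      have h2 := ENNReal.Tendsto.div_const (b := c) (h1.add h1) (Or.inr hc0)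
      simpa using (tendsto_const_nhds (x := μ A / a)).add h2
    exact ge_of_tendsto hlim (eventually_nhdsWithin_of_forall fun ε hε => key ε (ne_of_gt hε))
  · have key {a' : ℝ≥0∞} (haa : a < a') (ha' : a' ≠ ∞) : μ A ≤ a' * packingMeasure s A := by
      have ha0' : a' ≠ 0 := (zero_le.trans_lt haa).ne'
      rw [mul_comm, ← ENNReal.div_le_iff ha0' ha']
      refine le_iInf₂ fun F hF => ?_
      rw [ENNReal.div_le_iff ha0' ha', mul_comm, ← ENNReal.tsum_mul_left]
      calc μ A ≤ ∑' i, μ (F i) := (measure_mono hF.2).trans (measure_iUnion_le F)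
        _ ≤ _ := ENNReal.tsum_le_tsum fun i => by
          rw [← measure_inter_conull (s := F i) (t := Ehat)
            (mem_ae_iff.1 hEhat)]
          refine le_mul_packingPre ha0' ha' inter_subset_left fun x hx δ hδ => ?_
          obtain ⟨d, hd, h⟩ := exists_density_lt (hspec x hx.2) haa hδ
          refine ⟨d, hd, ?_⟩
          rw [← ENNReal.div_le_iff (ofReal_two_mul_rpow_ne_zero hd.1)
            (ofReal_two_mul_rpow_ne_top hs.le)]
          exact h.le
    rcases eq_or_ne (packingMeasure s A) ∞ with h | h
    · rw [h, ENNReal.mul_top ha0]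
      exact le_top
    have hne : (𝓝[>] a).NeBot := nhdsGT_neBot_of_exists_gt ⟨∞, lt_top_iff_ne_top.2 ha⟩
    have hlim : Tendsto (fun a' => a' * packingMeasure s A) (𝓝[>] a)
        (𝓝 (a * packingMeasure s A)) :=
      ENNReal.Tendsto.mul_const nhdsWithin_le_nhds (Or.inr h)
    refine ge_of_tendsto hlim ?_
    filter_upwards [Ioo_mem_nhdsGT (lt_top_iff_ne_top.2 ha)] with a' h' using key h'.1 h'.2.ne

end Formulas

/-! ### Outer measures with the scaling property -/

namespace IsNaturalMeasure

/-- Induction compares the two scaling relations level by level. At level `k` cylinders have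
diameter at most `q ^ k * D`, so those meeting `A` lie in that thickening of `A`; closedness of `K`
allows `k → ∞`. -/
lemma outerMeasure_inter_le (hf : IsSimilitudeSystem f r) (hE : IsSelfSimilarSet f E)
    (hdim : ∑ i, r i ^ s = 1) (hμ : IsNaturalMeasure f r s μ)
    {β : OuterMeasure (EuclideanSpace ℝ (Fin n))}
    (hβ : ∀ i A, β (f i '' A) ≤ ENNReal.ofReal (r i ^ s) * β A) (hfin : β E ≠ ∞)
    {K : Set (EuclideanSpace ℝ (Fin n))} (hK : IsClosed K) : β (K ∩ E) ≤ β E * μ K := by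
  have := hμ.isProbabilityMeasure
  obtain ⟨p, q, hp0, hp1, hq0, hq1, hpq⟩ := hf.exists_bounds
  obtain ⟨D, hD1, hD⟩ := hE.exists_bound
  have key (k : ℕ) : ∀ A, β (A ∩ E) ≤ β E * μ (Metric.cthickening (q ^ k * D) A) := by
    induction k with
    | zero =>
      intro A
      rcases (A ∩ E).eq_empty_or_nonempty with h | ⟨x, hxA, hxE⟩
      · simp [h]
      · have h1 : μ (Metric.cthickening (q ^ 0 * D) A) = 1 := by
          refine le_antisymm prob_le_one ?_
          rw [← hμ.measure_eq_one hf hE hdim]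
          refine measure_mono fun y hy => ?_
          exact Metric.mem_cthickening_of_dist_le _ x _ _ hxA (by simpa using hD y hy x hxE)
        rw [h1, mul_one]
        exact β.mono inter_subset_right
    | succ k ih =>
      intro A
      have hsub : A ∩ E ⊆ ⋃ i, f i '' (f i ⁻¹' A ∩ E) := by
        rintro x ⟨hxA, hxE⟩
        rw [hE.eq_iUnion] at hxE
        obtain ⟨i, y, hy, rfl⟩ := mem_iUnion.1 hxE
        exact mem_iUnion.2 ⟨i, y, ⟨hxA, hy⟩, rfl⟩
      calc β (A ∩ E) ≤ ∑ i, β (f i '' (f i ⁻¹' A ∩ E)) :=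
            (β.mono hsub).trans (measure_iUnion_fintype_le β _)
        _ ≤ ∑ i, ENNReal.ofReal (r i ^ s) *
              (β E * μ (f i ⁻¹' Metric.cthickening (q ^ (k + 1) * D) A)) := by
            refine Finset.sum_le_sum fun i _ => (hβ i _).trans ?_
            gcongr
            refine (ih _).trans ?_
            gcongr
            intro x hx
            rw [Metric.mem_cthickening_iff] at hx
            rw [mem_preimage, Metric.mem_cthickening_iff, pow_succ', mul_assoc,
              ENNReal.ofReal_mul hq0.le]
            have hr := (hf i).1
            calc Metric.infEDist (f i x) A
                ≤ ENNReal.ofReal (r i) * Metric.infEDist x (f i ⁻¹' A) := by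
                  simp only [Metric.infEDist]
                  rw [ENNReal.mul_iInf_of_ne (ENNReal.ofReal_pos.2 hr).ne' ENNReal.ofReal_ne_top]
                  refine le_iInf fun y => ?_
                  rw [ENNReal.mul_iInf_of_ne (ENNReal.ofReal_pos.2 hr).ne' ENNReal.ofReal_ne_top]
                  exact le_iInf fun hy => (iInf₂_le (f i y) hy).trans (hf.lipschitz i x y)
              _ ≤ _ := mul_le_mul' (ENNReal.ofReal_le_ofReal (hpq i).2) hx
        _ = β E * μ (Metric.cthickening (q ^ (k + 1) * D) A) := by
            rw [hμ.apply hf Metric.isClosed_cthickening.measurableSet, Finset.mul_sum]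
            exact Finset.sum_congr rfl fun i _ => mul_left_comm _ _ _
  have hlim : Tendsto (fun k : ℕ => q ^ k * D) atTop (𝓝 0) := by
    simpa using (tendsto_pow_atTop_nhds_zero_of_lt_one hq0.le hq1).mul_const D
  exact ge_of_tendsto' (ENNReal.Tendsto.const_mul
    ((tendsto_measure_cthickening_of_isClosed ⟨1, one_pos, measure_ne_top _ _⟩ hK).comp hlim)
    (Or.inr hfin)) fun k => key k K

/-- A finite outer measure with the scaling property is proportional to the natural measure on
closed sets. -/
lemma outerMeasure_inter_eq (hf : IsSimilitudeSystem f r) (hE : IsSelfSimilarSet f E)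
    (hdim : ∑ i, r i ^ s = 1) (hμ : IsNaturalMeasure f r s μ)
    {β : OuterMeasure (EuclideanSpace ℝ (Fin n))}
    (hβ : ∀ i A, β (f i '' A) ≤ ENNReal.ofReal (r i ^ s) * β A) (hfin : β E ≠ ∞)
    {K : Set (EuclideanSpace ℝ (Fin n))} (hK : IsClosed K) : β (K ∩ E) = β E * μ K := by
  have := hμ.isProbabilityMeasure
  refine le_antisymm (hμ.outerMeasure_inter_le hf hE hdim hβ hfin hK) ?_
  -- Efficient ball coverings extend the upper bound to `E \ K`. As the two upper bounds sum to `β E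
  -- < ∞`, subadditivity forces equality on `K ∩ E`.
  have key (ε : ℝ≥0∞) (hε : ε ≠ 0) : β (E \ K) ≤ β E * (μ (E \ K) + ε) := by
    obtain ⟨t, ρ, htc, -, -, htcov, htsum⟩ :=
      Besicovitch.exists_closedBall_covering_tsum_measure_le μ hε (fun _ => univ) (E \ K)
        (fun x _ δ hδ => ⟨δ / 2, mem_univ _, half_pos hδ, half_lt_self hδ⟩)
    calc β (E \ K) ≤ β (⋃ x ∈ t, Metric.closedBall x (ρ x) ∩ E) := β.mono fun x hx => by
          obtain ⟨y, hy, hxy⟩ := mem_iUnion₂.1 (htcov hx)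
          exact mem_iUnion₂.2 ⟨y, hy, hxy, hx.1⟩
      _ ≤ ∑' x : t, β (Metric.closedBall (x : EuclideanSpace ℝ (Fin n)) (ρ x) ∩ E) :=
          measure_biUnion_le β htc _
      _ ≤ ∑' x : t, β E * μ (Metric.closedBall (x : EuclideanSpace ℝ (Fin n)) (ρ x)) :=
          ENNReal.tsum_le_tsum fun x =>
            hμ.outerMeasure_inter_le hf hE hdim hβ hfin Metric.isClosed_closedBall
      _ ≤ _ := by
          rw [ENNReal.tsum_mul_left]
          gcongr
  have hdiff : β (E \ K) ≤ β E * μ (E \ K) := by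
    have hlim : Tendsto (fun ε => β E * (μ (E \ K) + ε)) (𝓝[>] 0) (𝓝 (β E * μ (E \ K))) := by
      refine ENNReal.Tendsto.const_mul ?_ (Or.inr hfin)
      have h1 : Tendsto (fun ε : ℝ≥0∞ => ε) (𝓝[>] 0) (𝓝 0) := nhdsWithin_le_nhds
      simpa using (tendsto_const_nhds (x := μ (E \ K))).add h1
    exact ge_of_tendsto hlim (eventually_nhdsWithin_of_forall fun ε hε => key ε (ne_of_gt hε))
  have h1 : β E * μ K + β E * μ (E \ K) ≤ β (K ∩ E) + β E * μ (E \ K) := by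
    calc β E * μ K + β E * μ (E \ K) = β E * 1 := by
          rw [← mul_add, ← measure_inter_conull (s := K) (hμ.measure_compl hf hE hdim),
            inter_comm, measure_inter_add_sdiff _ hK.measurableSet, hμ.measure_eq_one hf hE hdim]
      _ ≤ β (K ∩ E) + β (E \ K) := by
          rw [mul_one]
          refine le_trans (β.mono fun x hx => ?_) (measure_union_le (μ := β) _ _)
          by_cases h : x ∈ K
          exacts [Or.inl ⟨h, hx⟩, Or.inr ⟨hx, h⟩]
      _ ≤ _ := by gcongr
  exact (ENNReal.add_le_add_iff_right (ENNReal.mul_ne_top hfin (measure_ne_top _ _))).1 h1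

end IsNaturalMeasure

/-! ### The spherical and the Hausdorff measure -/

/-- The spherical Hausdorff measure as an outer measure. -/
noncomputable def sphericalOuter (n : ℕ) (s : ℝ) : OuterMeasure (EuclideanSpace ℝ (Fin n)) where
  measureOf := sphericalHausdorff s
  empty := by
    refine nonpos_iff_eq_zero.1 (iSup₂_le fun δ hδ => ?_)
    exact (iInf₂_le ∅ ⟨⟨countable_empty, by simp⟩, empty_subset _⟩).trans (by simp [ballSum])
  mono {A B} h := iSup₂_mono fun δ hδ => le_iInf₂ fun T hT =>
    iInf₂_le T ⟨hT.1, h.trans hT.2⟩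
  iUnion_nat A _ := by
    refine iSup₂_le fun δ hδ => ?_
    refine ENNReal.le_of_forall_pos_le_add fun ε hε hfin => ?_
    obtain ⟨ε', hε', hsum⟩ := ENNReal.exists_pos_sum_of_countable
      (ENNReal.coe_pos.2 hε).ne' ℕ
    have hT (k : ℕ) : ∃ T : Set (EuclideanSpace ℝ (Fin n) × ℝ),
        (IsBallFamily δ T ∧ Covers T (A k)) ∧
          ballSum s T ≤ sphericalHausdorff s (A k) + ε' k := by
      have h1 : sphericalHausdorff s (A k) ≠ ∞ := ne_top_of_le_ne_top hfin.ne (ENNReal.le_tsum k)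
      have h2 : (⨅ (T : Set (EuclideanSpace ℝ (Fin n) × ℝ))
          (_ : IsBallFamily δ T ∧ Covers T (A k)), ballSum s T) <
          sphericalHausdorff s (A k) + ε' k :=
        (le_iSup₂ (f := fun (δ : ℝ) (_ : 0 < δ) =>
          ⨅ (T : Set (EuclideanSpace ℝ (Fin n) × ℝ)) (_ : IsBallFamily δ T ∧ Covers T (A k)),
            ballSum s T) δ hδ).trans_lt
          (ENNReal.lt_add_right h1 (ENNReal.coe_pos.2 (hε' k)).ne')
      obtain ⟨T, hT⟩ := iInf_lt_iff.1 h2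
      obtain ⟨hT', hlt⟩ := iInf_lt_iff.1 hT
      exact ⟨T, hT', hlt.le⟩
    choose T hT hTs using hT
    have hmem : IsBallFamily δ (⋃ k, T k) ∧ Covers (⋃ k, T k) (⋃ k, A k) := by
      refine ⟨⟨countable_iUnion fun k => (hT k).1.1, fun p hp => ?_⟩,
        iUnion_subset fun k x hx => ?_⟩
      · obtain ⟨k, hk⟩ := mem_iUnion.1 hp
        exact (hT k).1.2 p hk
      · obtain ⟨p, hp, hxp⟩ := mem_iUnion₂.1 ((hT k).2 hx)
        exact mem_iUnion₂.2 ⟨p, mem_iUnion.2 ⟨k, hp⟩, hxp⟩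
    refine (iInf₂_le (⋃ k, T k) hmem).trans ?_
    calc ballSum s (⋃ k, T k) ≤ ∑' k, ballSum s (T k) :=
          ENNReal.tsum_iUnion_le_tsum
            (fun p : EuclideanSpace ℝ (Fin n) × ℝ => ENNReal.ofReal (2 * p.2) ^ s) T
      _ ≤ ∑' k, (sphericalHausdorff s (A k) + ε' k) := ENNReal.tsum_le_tsum hTs
      _ ≤ _ := by
          rw [ENNReal.tsum_add]
          gcongr

lemma IsSimilitudeSystem.sphericalHausdorff_image_le (hf : IsSimilitudeSystem f r) (hs : 0 < s)
    (i : Fin m) (A : Set (EuclideanSpace ℝ (Fin n))) :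
    sphericalHausdorff s (f i '' A) ≤ ENNReal.ofReal (r i ^ s) * sphericalHausdorff s A := by
  have hr := (hf i).1
  have hrs : ENNReal.ofReal (r i ^ s) ≠ 0 := (ENNReal.ofReal_pos.2 (Real.rpow_pos_of_pos hr s)).ne'
  refine iSup₂_le fun δ hδ => ?_
  rw [← ENNReal.div_le_iff' hrs ENNReal.ofReal_ne_top]
  refine le_trans ?_ (le_iSup₂ δ hδ)
  refine le_iInf₂ fun T hT => ?_
  rw [ENNReal.div_le_iff' hrs ENNReal.ofReal_ne_top]
  have hinj : Function.Injective
      fun p : EuclideanSpace ℝ (Fin n) × ℝ => (f i p.1, r i * p.2) := fun p p' h => by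
    rw [Prod.mk.injEq] at h
    exact Prod.ext (hf.injective i h.1) (mul_left_cancel₀ hr.ne' h.2)
  set T' := (fun p : EuclideanSpace ℝ (Fin n) × ℝ => (f i p.1, r i * p.2)) '' T with hT'
  have hmem : IsBallFamily δ T' ∧ Covers T' (f i '' A) := by
    refine ⟨⟨hT.1.1.image _, ?_⟩, ?_⟩
    · rintro _ ⟨p, hp, rfl⟩
      obtain ⟨h1, h2⟩ := hT.1.2 p hp
      exact ⟨mul_pos hr h1, by nlinarith [(hf i).2.1]⟩
    · rintro _ ⟨x, hx, rfl⟩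
      obtain ⟨p, hp, hxp⟩ := mem_iUnion₂.1 (hT.2 hx)
      refine mem_iUnion₂.2 ⟨_, mem_image_of_mem _ hp, ?_⟩
      rw [Metric.mem_closedBall, (hf i).2.2]
      exact mul_le_mul_of_nonneg_left hxp hr.le
  refine (iInf₂_le T' hmem).trans (le_of_eq ?_)
  rw [ballSum, hT',
    tsum_image (fun p : EuclideanSpace ℝ (Fin n) × ℝ => ENNReal.ofReal (2 * p.2) ^ s)
      hinj.injOn, ballSum, ← ENNReal.tsum_mul_left]
  refine tsum_congr fun p => ?_
  rw [mul_left_comm, ENNReal.ofReal_mul hr.le, ENNReal.mul_rpow_of_nonneg _ _ hs.le,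
    ENNReal.ofReal_rpow_of_pos hr]

lemma IsSimilitudeSystem.hausdorffMeasure_image_le (hf : IsSimilitudeSystem f r) (hs : 0 < s)
    (i : Fin m) (A : Set (EuclideanSpace ℝ (Fin n))) :
    Measure.hausdorffMeasure s (f i '' A) ≤
      ENNReal.ofReal (r i ^ s) * Measure.hausdorffMeasure s A := by
  have := (hf.lipschitz i).hausdorffMeasure_image_le hs.le A
  rwa [← ENNReal.ofReal, ENNReal.ofReal_rpow_of_pos (hf i).1] at this

lemma sphericalHausdorff_le_centredPre (A : Set (EuclideanSpace ℝ (Fin n))) :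
    sphericalHausdorff s A ≤ centredPre s A :=
  iSup₂_mono fun _ _ => le_iInf₂ fun T hT => iInf₂_le T ⟨hT.1, hT.2.2⟩

lemma hausdorffMeasure_le_sphericalHausdorff (hs : 0 < s) (A : Set (EuclideanSpace ℝ (Fin n))) :
    Measure.hausdorffMeasure s A ≤ sphericalHausdorff s A := by
  rw [Measure.hausdorffMeasure_apply]
  refine iSup₂_le fun ε hε => ?_
  obtain ⟨δ, hδ0, hδ⟩ : ∃ δ : ℝ, 0 < δ ∧ ENNReal.ofReal δ ≤ ε := by
    obtain ⟨δ, hδ0, hδ⟩ := ENNReal.lt_iff_exists_nnreal_btwn.1 hε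
    exact ⟨δ, by simpa using hδ0, by simpa using hδ.le⟩
  refine le_trans ?_ (le_iSup₂ δ hδ0)
  refine le_iInf₂ fun T hT => ?_
  have := hT.1.1.to_subtype
  have := Encodable.ofCountable T
  have hdiam (p : T) : Metric.ediam (Metric.closedBall (p : EuclideanSpace ℝ (Fin n) × ℝ).1
      (p : EuclideanSpace ℝ (Fin n) × ℝ).2) ≤
      ENNReal.ofReal (2 * (p : EuclideanSpace ℝ (Fin n) × ℝ).2) := by
    refine Metric.ediam_le fun y hy z hz => ?_
    rw [edist_dist]
    exact ENNReal.ofReal_le_ofReal ((dist_triangle_right y z _).trans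
      (by linarith [Metric.mem_closedBall.1 hy, Metric.mem_closedBall.1 hz]))
  refine (iInf_le_of_le (fun k => ⋃ p ∈ Encodable.decode₂ T k,
    Metric.closedBall (p : EuclideanSpace ℝ (Fin n) × ℝ).1
      (p : EuclideanSpace ℝ (Fin n) × ℝ).2) (iInf₂_le ?_ ?_)).trans ?_
  · rw [Encodable.iUnion_decode₂]
    simpa [Covers] using hT.2
  · exact fun k => Encodable.iUnion_decode₂_cases (C := fun t => Metric.ediam t ≤ ε) (by simp)
      fun p => (hdiam p).trans ((ENNReal.ofReal_le_ofReal (hT.1.2 p p.2).2).trans hδ)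
  · rw [tsum_iUnion_decode₂ (fun t : Set (EuclideanSpace ℝ (Fin n)) =>
      ⨆ _ : t.Nonempty, Metric.ediam t ^ s) (by simp)]
    exact ENNReal.tsum_le_tsum fun p => iSup_le fun _ =>
      ENNReal.rpow_le_rpow (hdiam p) hs.le

/-- The mass distribution principle. -/
lemma hausdorffMeasure_pos (hs : 0 < s) {c : ℝ≥0∞} (hc0 : c ≠ 0) (hc : c ≠ ∞)
    (hup : ∀ x : EuclideanSpace ℝ (Fin n), ∀ d : ℝ, 0 < d → d ≤ 1 →
      μ (Metric.closedBall x d) ≤ c * ENNReal.ofReal (2 * d) ^ s) (hE : μ E ≠ 0) :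
    0 < Measure.hausdorffMeasure s E := by
  have h2 : (2 : ℝ≥0∞) ^ s ≠ 0 := (ENNReal.rpow_pos (by simp) (by simp)).ne'
  have h2' : (2 : ℝ≥0∞) ^ s ≠ ∞ := ENNReal.rpow_ne_top_of_nonneg hs.le (by simp)
  -- A set `U` lies in balls centred in it with radius just above `diam U`, hence the factor `2 ^
  -- s`. The radius decreases to `diam U` because a singleton has diameter zero; the threshold `1 /
  -- 2` leaves room below `1`.
  have hle : (c * 2 ^ s)⁻¹ • μ ≤ Measure.hausdorffMeasure s := by
    refine Measure.le_hausdorffMeasure s _ (ENNReal.ofReal (1 / 2)) (by simp) fun U hU => ?_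
    rcases U.eq_empty_or_nonempty with rfl | ⟨x, hx⟩
    · simp
    have hUtop : Metric.ediam U ≠ ∞ := ne_top_of_le_ne_top ENNReal.ofReal_ne_top hU
    have hUd : Metric.diam U ≤ 1 / 2 := ENNReal.toReal_le_of_le_ofReal (by norm_num) hU
    have hUb : Bornology.IsBounded U := Metric.isBounded_iff_ediam_ne_top.2 hUtop
    have hlim : Tendsto (fun d => c * ENNReal.ofReal (2 * d) ^ s) (𝓝[>] Metric.diam U)
        (𝓝 (c * ENNReal.ofReal (2 * Metric.diam U) ^ s)) := by
      refine ENNReal.Tendsto.const_mul ?_ (Or.inr hc)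
      exact ((ENNReal.continuous_rpow_const.comp
        (ENNReal.continuous_ofReal.comp (continuous_const.mul continuous_id))).tendsto
          _).mono_left nhdsWithin_le_nhds
    have hμU : μ U ≤ c * ENNReal.ofReal (2 * Metric.diam U) ^ s := by
      refine ge_of_tendsto hlim ?_
      filter_upwards [Ioc_mem_nhdsGT (show Metric.diam U < 1 by linarith)] with d hd
      refine le_trans (measure_mono fun y hy => ?_)
        (hup x d (Metric.diam_nonneg.trans_lt hd.1) hd.2)
      exact (Metric.dist_le_diam_of_mem hUb hy hx).trans hd.1.le
    rw [Measure.smul_apply, smul_eq_mul, mul_comm, ← div_eq_mul_inv,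
      ENNReal.div_le_iff (mul_ne_zero hc0 h2) (ENNReal.mul_ne_top hc h2')]
    refine hμU.trans (le_of_eq ?_)
    rw [ENNReal.ofReal_mul zero_le_two, Metric.diam, ENNReal.ofReal_toReal hUtop,
      ENNReal.mul_rpow_of_nonneg _ _ hs.le]
    simp only [ENNReal.ofReal_ofNat]
    ring
  refine lt_of_lt_of_le ?_ (hle E)
  rw [Measure.smul_apply, smul_eq_mul, pos_iff_ne_zero]
  exact mul_ne_zero (ENNReal.inv_ne_zero.2 (ENNReal.mul_ne_top hc h2')) hE

/-! ### The spectrum of the natural measure -/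

namespace IsNaturalMeasure

lemma Spec_subset_Icc (hs : 0 < s) {c₁ c₂ : ℝ≥0∞}
    (hlow : ∀ x ∈ E, ∀ d : ℝ, 0 < d → d ≤ 1 →
      c₁ * ENNReal.ofReal (2 * d) ^ s ≤ μ (Metric.closedBall x d))
    (hup : ∀ x : EuclideanSpace ℝ (Fin n), ∀ d : ℝ, 0 < d → d ≤ 1 →
      μ (Metric.closedBall x d) ≤ c₂ * ENNReal.ofReal (2 * d) ^ s) :
    Spec (fun A => μ A) s E ⊆ Icc c₁ c₂ := by
  rintro L ⟨x, hx, d, hd, hd0, hL⟩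
  refine isClosed_Icc.mem_of_tendsto hL ?_
  filter_upwards [hd0.eventually (gt_mem_nhds one_pos)] with k hk
  have h0 := ofReal_two_mul_rpow_ne_zero (s := s) (hd k)
  have h1 := ofReal_two_mul_rpow_ne_top (d := d k) hs.le
  constructor
  · rw [density, ENNReal.le_div_iff_mul_le (Or.inl h0) (Or.inl h1)]
    exact hlow x hx _ (hd k) hk.le
  · rw [density, ENNReal.div_le_iff h0 h1]
    exact hup x _ (hd k) hk.le

/-- The structure of the spectrum of the natural measure, together with the identification of
the extreme values through the packing and centred measures. -/
lemma exists_spectrum (hf : IsSimilitudeSystem f r) (hE : IsSelfSimilarSet f E) (hs : 0 < s)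
    (hdim : ∑ i, r i ^ s = 1) (hμ : IsNaturalMeasure f r s μ) (hO : IsFeasible f E O) :
    ∃ a b : ℝ≥0∞, a ≠ 0 ∧ a ≠ ∞ ∧ b ≠ 0 ∧ b ≠ ∞ ∧
      (∃ Ehat ⊆ O ∩ E, MeasurableSet Ehat ∧ μ Ehat = 1 ∧
        ∀ y ∈ Ehat, Spec (fun A => μ A) s {y} = Icc a b) ∧
      Spec (fun A => μ A) s (O ∩ E) = Icc a b ∧
      Ioo a b ⊆ typicalDensities f E (fun A => μ A) s ∧
      typicalDensities f E (fun A => μ A) s ⊆ Icc a b ∧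
      (∀ A ⊆ E, MeasurableSet A → b * centredHausdorff s A = μ A) ∧
      (∀ A ⊆ E, MeasurableSet A → a * packingMeasure s A = μ A) := by
  have := hμ.isProbabilityMeasure
  obtain ⟨c₁, hc₁0, hc₁, hlow⟩ := hμ.exists_lower_bound hf hE hs hdim
  obtain ⟨c₂, hc₂0, hc₂, hup⟩ := hμ.exists_upper_bound hf hE hs hdim hO
  have hEae : E ∈ ae μ := mem_ae_iff.2 (hμ.measure_compl hf hE hdim)
  have hOae : O ∈ ae μ := (mem_ae_iff_prob_eq_one hO.isOpen.measurableSet).2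
    (hμ.feasible_eq_one hf hE hdim hO)
  have hmeas : MeasurableSet (richPoints f E ∩ (O ∩ E)) := (measurableSet_richPoints hf hE).inter
    (hO.isOpen.measurableSet.inter hE.isCompact.measurableSet)
  have hEhat : richPoints f E ∩ (O ∩ E) ∈ ae μ :=
    inter_mem (hμ.richPoints_mem_ae hf hE hdim) (inter_mem hOae hEae)
  obtain ⟨y₀, hy₀⟩ : (richPoints f E ∩ (O ∩ E)).Nonempty := nonempty_of_mem hEhat
  have hmono (x : EuclideanSpace ℝ (Fin n)) :
      Monotone fun d => (fun A => μ A) (Metric.closedBall x d) :=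
    fun d e h => measure_mono (Metric.closedBall_subset_closedBall h)
  have hspec : ∀ y ∈ richPoints f E ∩ (O ∩ E),
      Spec (fun A => μ A) s {y} = Spec (fun A => μ A) s (O ∩ E) :=
    fun y hy => hμ.Spec_singleton_eq hf hE hs hdim hO hy.1 hy.2
  have hIcc := (hspec y₀ hy₀).symm.trans (Spec_singleton_eq_Icc hs (hmono y₀))
  set a := lowerDensity (fun A => μ A) s y₀ with ha
  set b := upperDensity (fun A => μ A) s y₀ with hb
  have hab : a ≤ b := liminf_le_limsup
  have hsubE : Spec (fun A => μ A) s (O ∩ E) ⊆ Spec (fun A => μ A) s E := by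
    rintro L ⟨x, hx, h⟩
    exact ⟨x, hx.2, h⟩
  have hbounds : Icc a b ⊆ Icc c₁ c₂ :=
    hIcc ▸ hsubE.trans (Spec_subset_Icc hs hlow hup)
  have hca := (hbounds ⟨le_rfl, hab⟩).1
  have hbc := (hbounds ⟨hab, le_rfl⟩).2
  have ha0 : a ≠ 0 := ((pos_iff_ne_zero.2 hc₁0).trans_le hca).ne'
  have hbt : b ≠ ∞ := ne_top_of_le_ne_top hc₂ hbc
  have hb0 : b ≠ 0 := ((pos_iff_ne_zero.2 ha0).trans_le hab).ne'
  have hat : a ≠ ∞ := ne_top_of_le_ne_top hbt hab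
  have htyp : typicalDensities f E (fun A => μ A) s ⊆ Icc a b := by
    rintro t ⟨x, d, hxd, rfl⟩
    rw [← hIcc, ← hspec y₀ hy₀]
    exact hμ.density_mem_Spec hf hE hs hdim hxd hy₀.1
  refine ⟨a, b, ha0, hat, hb0, hbt, ⟨_, inter_subset_right, hmeas,
    (mem_ae_iff_prob_eq_one hmeas).1 hEhat, fun y hy => (hspec y hy).trans hIcc⟩, hIcc, ?_, htyp,
    fun A hAE hA => ?_, fun A hAE hA => ?_⟩
  · intro t ht
    obtain ⟨ε, hε, hεO⟩ := Metric.nhds_basis_closedBall.mem_iff.1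
      (hO.isOpen.mem_nhds hy₀.2.1)
    obtain ⟨d, hd, hdt⟩ := ((nhdsGT_basis (0 : ℝ)).frequently_iff.1
      (frequently_density_eq hs (hmono y₀) ht)) ε hε
    exact ⟨y₀, d, ⟨hy₀.2.2, hd.1, O, hO,
      (Metric.closedBall_subset_closedBall hd.2.le).trans hεO⟩, hdt.symm⟩
  · refine mul_centredHausdorff_eq hO.isOpen hs hb0 hbt hc₁0 hc₁ hlow hEhat hOae
      (fun x hx d hd hxd => (htyp ⟨x, d, ⟨hx.2, hd, O, hO, hxd⟩, rfl⟩).2) (fun y hy => ?_) hA hAE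
    rw [hspec y hy, hIcc]
    exact ⟨hab, le_rfl⟩
  · refine mul_packingMeasure_eq hE.isCompact.isClosed hO.isOpen hs ha0 hat hc₁0 hc₁ hlow hEhat
      hOae (fun x hx d hd hxd => (htyp ⟨x, d, ⟨hx.2, hd, O, hO, hxd⟩, rfl⟩).1) (fun y hy => ?_)
      hA hAE
    rw [hspec y hy, hIcc]
    exact ⟨le_rfl, hab⟩

/-- Every member of the family of metric measures is a positive finite multiple of the natural
measure on closed sets. -/
lemma metricMeasures_eq (hf : IsSimilitudeSystem f r) (hE : IsSelfSimilarSet f E) (hs : 0 < s)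
    (hdim : ∑ i, r i ^ s = 1) (hμ : IsNaturalMeasure f r s μ) (hO : IsFeasible f E O)
    {α : Set (EuclideanSpace ℝ (Fin n)) → ℝ≥0∞} (hα : α ∈ metricMeasures s E μ) :
    α E ≠ 0 ∧ α E ≠ ∞ ∧ ∀ K, IsClosed K → α K = α E * μ K := by
  have := hμ.isProbabilityMeasure
  obtain ⟨a, b, ha0, ha, hb0, hb, -, -, -, -, hC, hP⟩ := hμ.exists_spectrum hf hE hs hdim hO
  obtain ⟨c₂, hc₂0, hc₂, hup⟩ := hμ.exists_upper_bound hf hE hs hdim hO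
  have hEm := hE.isCompact.measurableSet
  have hμE := hμ.measure_eq_one hf hE hdim
  have hinter (K : Set (EuclideanSpace ℝ (Fin n))) : μ (K ∩ E) = μ K :=
    measure_inter_conull (hμ.measure_compl hf hE hdim)
  have hHpos : 0 < Measure.hausdorffMeasure s E :=
    hausdorffMeasure_pos hs hc₂0 hc₂ hup (by simp [hμE])
  have hHS := hausdorffMeasure_le_sphericalHausdorff hs E
  have hCE : centredHausdorff s E ≠ ∞ := fun h => by
    have := hC E subset_rfl hEm
    rw [h, ENNReal.mul_top hb0, hμE] at this
    exact ENNReal.top_ne_one this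
  -- Finiteness descends from `C^s(E) = 1 / b` through `H^s ≤ H_Sph^s ≤ C_0^s ≤ C^s`; positivity
  -- climbs from `H^s` by mass distribution.
  have hSE : sphericalHausdorff s E ≠ ∞ := by
    refine ne_top_of_le_ne_top hCE ((sphericalHausdorff_le_centredPre E).trans ?_)
    exact le_iSup₂ (f := fun (F : Set (EuclideanSpace ℝ (Fin n))) (_ : F ⊆ E ∧ IsClosed F) =>
      centredPre s F) E ⟨subset_rfl, hE.isCompact.isClosed⟩
  have hprop {c : ℝ≥0∞} (hc0 : c ≠ 0) (hc : c ≠ ∞)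
      {β : Set (EuclideanSpace ℝ (Fin n)) → ℝ≥0∞}
      (hβ : ∀ A ⊆ E, MeasurableSet A → c * β A = μ A) :
      β (E ∩ E) ≠ 0 ∧ β (E ∩ E) ≠ ∞ ∧ ∀ K, IsClosed K → β (K ∩ E) = β (E ∩ E) * μ K := by
    have heq (A) (hAE : A ⊆ E) (hA : MeasurableSet A) : β A = c⁻¹ * μ A := by
      rw [← hβ A hAE hA, ← mul_assoc, ENNReal.inv_mul_cancel hc0 hc, one_mul]
    rw [inter_self, heq E subset_rfl hEm, hμE, mul_one]
    exact ⟨ENNReal.inv_ne_zero.2 hc, ENNReal.inv_ne_top.2 hc0, fun K hK => by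
      rw [heq _ inter_subset_right (hK.measurableSet.inter hEm), hinter]⟩
  rcases hα with rfl | rfl | rfl | rfl | rfl
  · exact ⟨by simp [hμE], by simp [hμE], fun K _ => by simp [hμE]⟩
  · simp only [inter_self]
    exact ⟨hHpos.ne', ne_top_of_le_ne_top hSE hHS, fun K hK =>
      hμ.outerMeasure_inter_eq hf hE hdim
        (β := (Measure.hausdorffMeasure s : Measure (EuclideanSpace ℝ (Fin n))).toOuterMeasure)
        (hf.hausdorffMeasure_image_le hs) (ne_top_of_le_ne_top hSE hHS) hK⟩
  · simp only [inter_self]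
    exact ⟨(hHpos.trans_le hHS).ne', hSE, fun K hK =>
      hμ.outerMeasure_inter_eq hf hE hdim (β := sphericalOuter n s)
        (hf.sphericalHausdorff_image_le hs) hSE hK⟩
  · exact hprop hb0 hb hC
  · exact hprop ha0 ha hP

end IsNaturalMeasure

/-! ### Multiples of a set function -/

section Scaling

variable {α β : Set (EuclideanSpace ℝ (Fin n)) → ℝ≥0∞} {M : ℝ≥0∞}

lemma Spec_eq_image (hM0 : M ≠ 0) (hM : M ≠ ∞) (h : ∀ x d, density α s x d = M * density β s x d)
    (A : Set (EuclideanSpace ℝ (Fin n))) : Spec α s A = (M * ·) '' Spec β s A := by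
  ext L
  constructor
  · rintro ⟨x, hx, d, hd, hd0, hL⟩
    refine ⟨M⁻¹ * L, ⟨x, hx, d, hd, hd0, ?_⟩, ENNReal.mul_inv_cancel_left hM0 hM⟩
    have := ENNReal.Tendsto.const_mul (a := M⁻¹) hL (Or.inr (ENNReal.inv_ne_top.2 hM0))
    simpa [h, ENNReal.inv_mul_cancel_left hM0 hM] using this
  · rintro ⟨L, ⟨x, hx, d, hd, hd0, hL⟩, rfl⟩
    refine ⟨x, hx, d, hd, hd0, ?_⟩
    simpa [h] using ENNReal.Tendsto.const_mul (a := M) hL (Or.inr hM)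

lemma typicalDensities_eq_image (h : ∀ x d, density α s x d = M * density β s x d) :
    typicalDensities f E α s = (M * ·) '' typicalDensities f E β s := by
  ext t
  constructor
  · rintro ⟨x, d, hxd, rfl⟩
    exact ⟨_, ⟨x, d, hxd, rfl⟩, (h x d).symm⟩
  · rintro ⟨_, ⟨x, d, hxd, rfl⟩, rfl⟩
    exact ⟨x, d, hxd, (h x d).symm⟩

end Scaling

end SelfSimilarSpectrum

/-! ### The main theorem: transfer from `μ` to `α` -/

theorem theorem3p8 {n m : ℕ}
    (f : Fin m → EuclideanSpace ℝ (Fin n) → EuclideanSpace ℝ (Fin n)) (r : Fin m → ℝ)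
    (hf : SelfSimilarSpectrum.IsSimilitudeSystem f r)
    (E : Set (EuclideanSpace ℝ (Fin n))) (hE : SelfSimilarSpectrum.IsSelfSimilarSet f E)
    (O : Set (EuclideanSpace ℝ (Fin n))) (hO : SelfSimilarSpectrum.IsFeasible f E O)
    (s : ℝ) (hs : 0 < s) (hdim : ∑ i, r i ^ s = 1)
    (μ : Measure (EuclideanSpace ℝ (Fin n)))
    (hμ : SelfSimilarSpectrum.IsNaturalMeasure f r s μ)
    (α : Set (EuclideanSpace ℝ (Fin n)) → ℝ≥0∞)
    (hα : α ∈ SelfSimilarSpectrum.metricMeasures s E μ) :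
    -- (i)
    ((∀ x ∈ E, SelfSimilarSpectrum.Spec α s {x} =
        Set.Icc (SelfSimilarSpectrum.lowerDensity α s x)
          (SelfSimilarSpectrum.upperDensity α s x)) ∧
      ∃ κ₁ κ₂ : ℝ≥0∞, 0 < κ₁ ∧ κ₁ ≤ κ₂ ∧ κ₂ < ∞ ∧
        SelfSimilarSpectrum.Spec α s E ⊆ Set.Icc κ₁ κ₂) ∧
    -- (ii)
    (∃ Ehat : Set (EuclideanSpace ℝ (Fin n)), Ehat ⊆ E ∧ MeasurableSet Ehat ∧ μ Ehat = 1 ∧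
      ∀ y ∈ Ehat,
        SelfSimilarSpectrum.Spec α s {y} = SelfSimilarSpectrum.Spec α s Ehat ∧
        SelfSimilarSpectrum.Spec α s Ehat = SelfSimilarSpectrum.Spec α s (O ∩ E)) ∧
    -- (iii)
    (Set.Ioo (α E / SelfSimilarSpectrum.packingMeasure s E)
          (α E / SelfSimilarSpectrum.centredHausdorff s E)
        ⊆ SelfSimilarSpectrum.typicalDensities f E α s ∧
      SelfSimilarSpectrum.typicalDensities f E α s ⊆ SelfSimilarSpectrum.Spec α s (O ∩ E) ∧
      SelfSimilarSpectrum.Spec α s (O ∩ E) ⊆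
        Set.Icc (α E / SelfSimilarSpectrum.packingMeasure s E)
          (α E / SelfSimilarSpectrum.centredHausdorff s E)) := by

  have := hμ.isProbabilityMeasure
  obtain ⟨a, b, ha0, ha, hb0, hb, ⟨Ehat, hEhatO, hEhatm, hEhat1, hEhat⟩, hSpec, hIoo, htyp,
    hC, hP⟩ := hμ.exists_spectrum hf hE hs hdim hO
  obtain ⟨c₁, hc₁0, hc₁, hlow⟩ := hμ.exists_lower_bound hf hE hs hdim
  obtain ⟨c₂, hc₂0, hc₂, hup⟩ := hμ.exists_upper_bound hf hE hs hdim hO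
  obtain ⟨hM0, hM, hαK⟩ := hμ.metricMeasures_eq hf hE hs hdim hO hα
  have hμE := hμ.measure_eq_one hf hE hdim
  have hEm := hE.isCompact.measurableSet
  set M := α E with hMdef
  have hden (x : EuclideanSpace ℝ (Fin n)) (d : ℝ) : SelfSimilarSpectrum.density α s x d =
      M * SelfSimilarSpectrum.density (fun A => μ A) s x d := by
    rw [SelfSimilarSpectrum.density, hαK _ Metric.isClosed_closedBall, mul_div_assoc]
    rfl
  have himage := SelfSimilarSpectrum.Spec_eq_image hM0 hM hden
  -- Since `μ E = 1`, the endpoints `M / P^s(E)` and `M / C^s(E)` become `M * a` and `M * b`.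
  have hinv {c t : ℝ≥0∞} (hc0 : c ≠ 0) (h : c * t = μ E) : M / t = M * c := by
    rw [hμE] at h
    rw [ENNReal.eq_inv_of_mul_eq_one_left ((mul_comm t c).trans h), div_eq_mul_inv, inv_inv]
  rw [hinv hb0 (hC E subset_rfl hEm), hinv ha0 (hP E subset_rfl hEm)]
  have hmulIcc (u v : ℝ≥0∞) {t : ℝ≥0∞} (ht : t ∈ Icc u v) : M * t ∈ Icc (M * u) (M * v) :=
    ⟨mul_le_mul_right ht.1 M, mul_le_mul_right ht.2 M⟩
  have hSpecEhat : SelfSimilarSpectrum.Spec α s Ehat =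
      SelfSimilarSpectrum.Spec α s (O ∩ E) := by
    rw [himage, himage, hSpec]
    congr 1
    ext L
    constructor
    · rintro ⟨x, hx, h⟩
      rw [← hEhat x hx]
      exact ⟨x, rfl, h⟩
    · intro hL
      obtain ⟨y, hy⟩ : Ehat.Nonempty :=
        nonempty_of_measure_ne_zero (μ := μ) (by simp [hEhat1])
      rw [← hEhat y hy] at hL
      obtain ⟨x, rfl, h⟩ := hL
      exact ⟨x, hy, h⟩
  -- The maximum gives `κ₁ ≤ κ₂` without comparing the two Ahlfors constants.
  refine ⟨⟨fun x _ => ?_, M * c₁, M * max c₁ c₂, ?_, ?_, ?_, ?_⟩,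
    ⟨Ehat, hEhatO.trans inter_subset_right, hEhatm, hEhat1, fun y hy => ⟨?_, hSpecEhat⟩⟩,
    ?_, ?_, ?_⟩
  · refine SelfSimilarSpectrum.Spec_singleton_eq_Icc hs fun d e hde => ?_
    simp only [hαK _ Metric.isClosed_closedBall]
    gcongr
  · exact pos_iff_ne_zero.2 (mul_ne_zero hM0 hc₁0)
  · exact mul_le_mul_right (le_max_left _ _) M
  · exact ENNReal.mul_lt_top hM.lt_top (max_lt hc₁.lt_top hc₂.lt_top)
  · rw [himage]
    rintro _ ⟨L, hL, rfl⟩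
    have h := SelfSimilarSpectrum.IsNaturalMeasure.Spec_subset_Icc hs hlow hup hL
    exact hmulIcc _ _ ⟨h.1, h.2.trans (le_max_right _ _)⟩
  · rw [hSpecEhat, himage, himage, hEhat y hy, hSpec]
  · intro t ht
    rw [SelfSimilarSpectrum.typicalDensities_eq_image hden]
    refine ⟨M⁻¹ * t, hIoo ?_, ENNReal.mul_inv_cancel_left hM0 hM⟩
    rw [mul_comm M⁻¹, ← div_eq_mul_inv]
    exact ⟨by rw [ENNReal.lt_div_iff_mul_lt (Or.inl hM0) (Or.inl hM), mul_comm]; exact ht.1,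
      by rw [ENNReal.div_lt_iff (Or.inl hM0) (Or.inl hM), mul_comm]; exact ht.2⟩
  · rw [SelfSimilarSpectrum.typicalDensities_eq_image hden, himage, hSpec]
    exact image_mono htyp
  · rw [himage, hSpec]
    rintro _ ⟨L, hL, rfl⟩
    exact hmulIcc _ _ hL
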